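/- Let $M_0$ be the boundary of the unit square $[0,1]^2$. A \emph{square metric space} is a metric space $(X,d_X)$ with all distances at most $2$, together with an injective map $S_X\colon M_0\to X$ such that (sq$_1$) for $i\in\{0,1\}$ and $r,s\in[0,1]$, $d_X(S_X(i,r),S_X(i,s))=|s-r|$ and $d_X(S_X(r,i),S_X(s,i))=|s-r|$; (sq$_2$) $d_X(S_X(r,s),S_X(t,u))\ge |r-t|+|s-u|$ for all $(r,s),(t,u)\in M_0$. Let $\mathsf{SquaMS}$ be the category of square metric spaces, whose morphisms are the short (i.e. $1$-Lipschitz) maps $f$ with $f\circ S_X=S_Y$. Let $M=\{0,1,2\}^2\setminus\{(1,1)\}$, whose elements $(i,j)$ are the (column, row) positions of the eight outer cells of a $3\times3$ grid. For a square metric space $X$, let $\sim$ be the equivalence relation on $M\times X$ generated by gluing the copies of $X$ along the common sides of adjacent cells: for $r\in[0,1]$, $((i,j),S_X(r,1))\sim((i,j+1),S_X(r,0))$ if $(i,j),(i,j+1)\in M$, and $((i,j),S_X(1,r))\sim((i+1,j),S_X(0,r))$ if $(i,j),(i+1,j)\in M$. Let $M\otimes X=(M\times X)/{\sim}$, and write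 $m\otimes x$ for the class of $(m,x)$. The distance of $m\otimes x$ and $n\otimes y$ is the infimum of the scores of all finite paths from $(m,x)$ to $(n,y)$ in $M\times X$, where the score is the sum over consecutive points of the path of: $0$ if they are related by $\sim$; otherwise $\frac13d_X(x',y')$ for points $(m',x'),(m',y')$ of the same copy, and $2$ for points of different copies. The boundary map is $S_{M\otimes X}(p)=m\otimes S_X(q)$ for any $m\in M$, $q\in M_0$ with $m+q=3p$. With $(M\otimes f)(m\otimes x)=m\otimes f(x)$ this is an endofunctor $M\otimes-$ of $\mathsf{SquaMS}$. Let $C$ be the Cauchy completion functor on $\mathsf{SquaMS}$ (with $S_{C(X)}$ the composite of $S_X$ and the embedding $X\to C(X)$), and let $\delta_X\colon M\otimes C(X)\to C(M\otimes X)$ be the canonical morphism $m\otimes\lim_k x_k\mapsto\lim_k(m\otimes x_k)$. \textbf{Theorem.} The functor $M\otimes-$ on $\mathsf{SquaMS}$ has an initial algebra. If $(G,\eta\colon M\otimes G\to G)$ is an initial algebra, then $\eta$ and $\delta_G$ are isomorphisms, and, with $Q=C(G)$ and $$\gamma=\delta_G^{-1}\circ C(\eta^{-1})\colon Q=C(G)\to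 C(M\otimes G)\cong M\otimes C(G)=M\otimes Q,$$ $(Q,\gamma)$ is a final coalgebra of $M\otimes-$ on $\mathsf{SquaMS}$: for every coalgebra $(B,\beta\colon B\to M\otimes B)$ there is a unique morphism $h\colon B\to Q$ of $\mathsf{SquaMS}$ with $\gamma\circ h=(M\otimes h)\circ\beta$. -/

import Mathlib

open CategoryTheory UniformSpace

universe u

noncomputable section

/-! ## The boundary of the unit square -/

/-- The boundary `M₀` of the unit square `[0,1]²`. -/
def SquareBoundary : Type :=
  {p : ℝ × ℝ // p.1 ∈ Set.Icc (0 : ℝ) 1 ∧ p.2 ∈ Set.Icc (0 : ℝ) 1 ∧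
    ((p.1 = 0 ∨ p.1 = 1) ∨ (p.2 = 0 ∨ p.2 = 1))}

namespace SquareBoundary

/-- The point `(0, r)` of the left side. -/
def left (r : Set.Icc (0 : ℝ) 1) : SquareBoundary :=
  ⟨(0, r), by simp, r.2, by simp⟩

/-- The point `(1, r)` of the right side. -/
def right (r : Set.Icc (0 : ℝ) 1) : SquareBoundary :=
  ⟨(1, r), by simp, r.2, by simp⟩

/-- The point `(r, 0)` of the bottom side. -/
def bottom (r : Set.Icc (0 : ℝ) 1) : SquareBoundary :=
  ⟨(r, 0), r.2, by simp, by simp⟩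

/-- The point `(r, 1)` of the top side. -/
def top (r : Set.Icc (0 : ℝ) 1) : SquareBoundary :=
  ⟨(r, 1), r.2, by simp, by simp⟩

/-- First coordinate. -/
def fst (p : SquareBoundary) : ℝ := p.1.1

/-- Second coordinate. -/
def snd (p : SquareBoundary) : ℝ := p.1.2

theorem ext' {p q : SquareBoundary} (h1 : p.fst = q.fst) (h2 : p.snd = q.snd) : p = q :=
  Subtype.ext (Prod.ext h1 h2)

theorem fst_nonneg (p : SquareBoundary) : 0 ≤ p.fst := p.2.1.1
theorem fst_le (p : SquareBoundary) : p.fst ≤ 1 := p.2.1.2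
theorem snd_nonneg (p : SquareBoundary) : 0 ≤ p.snd := p.2.2.1.1
theorem snd_le (p : SquareBoundary) : p.snd ≤ 1 := p.2.2.1.2
theorem fst_mem (p : SquareBoundary) : p.fst ∈ Set.Icc (0 : ℝ) 1 := p.2.1
theorem snd_mem (p : SquareBoundary) : p.snd ∈ Set.Icc (0 : ℝ) 1 := p.2.2.1

theorem eq_left {p : SquareBoundary} (h : p.fst = 0) :
    p = left ⟨p.snd, p.snd_mem⟩ := ext' h rfl
theorem eq_right {p : SquareBoundary} (h : p.fst = 1) :
    p = right ⟨p.snd, p.snd_mem⟩ := ext' h rfl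
theorem eq_bottom {p : SquareBoundary} (h : p.snd = 0) :
    p = bottom ⟨p.fst, p.fst_mem⟩ := ext' rfl h
theorem eq_top {p : SquareBoundary} (h : p.snd = 1) :
    p = top ⟨p.fst, p.fst_mem⟩ := ext' rfl h

end SquareBoundary

/-! ## The category of square metric spaces -/

/-- A square metric space: a metric space bounded by `2` with an injective map `S` from the
boundary of the unit square such that, along each of the four sides, distances are those of the
unit interval (`sq₁`), and all distances between boundary points are at least the taxicab
distances (`sq₂`). -/
structure SquaMS : Type (u + 1) where
  carrier : Type u
  [metric : MetricSpace carrier]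
  dist_le_two : ∀ x y : carrier, dist x y ≤ 2
  S : SquareBoundary → carrier
  S_injective : Function.Injective S
  sq₁_left : ∀ r s : Set.Icc (0 : ℝ) 1, dist (S (.left r)) (S (.left s)) = |(s : ℝ) - r|
  sq₁_right : ∀ r s : Set.Icc (0 : ℝ) 1, dist (S (.right r)) (S (.right s)) = |(s : ℝ) - r|
  sq₁_bottom : ∀ r s : Set.Icc (0 : ℝ) 1, dist (S (.bottom r)) (S (.bottom s)) = |(s : ℝ) - r|
  sq₁_top : ∀ r s : Set.Icc (0 : ℝ) 1, dist (S (.top r)) (S (.top s)) = |(s : ℝ) - r|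
  sq₂ : ∀ p q : SquareBoundary, |p.fst - q.fst| + |p.snd - q.snd| ≤ dist (S p) (S q)

namespace SquaMS

instance : CoeSort SquaMS.{u} (Type u) := ⟨SquaMS.carrier⟩

instance (X : SquaMS.{u}) : MetricSpace X := X.metric

/-- Morphisms of square metric spaces: short maps that preserve `S`. -/
@[ext]
structure Hom (X Y : SquaMS.{u}) : Type u where
  toFun : X → Y
  short : ∀ x y : X, dist (toFun x) (toFun y) ≤ dist x y
  map_S : ∀ p : SquareBoundary, toFun (X.S p) = Y.S p

instance : Category SquaMS.{u} where
  Hom := Hom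
  id X := ⟨fun x => x, fun _ _ => le_rfl, fun _ => rfl⟩
  comp f g := ⟨fun x => g.toFun (f.toFun x),
    fun x y => (g.short _ _).trans (f.short x y),
    fun p => by rw [f.map_S, g.map_S]⟩

theorem Hom.lipschitz {X Y : SquaMS.{u}} (f : Hom X Y) : LipschitzWith 1 f.toFun :=
  LipschitzWith.of_dist_le_mul (by simpa using f.short)

/-! ## The Cauchy completion functor -/

/-- The Cauchy completion of a square metric space; `S` is composed with the canonical
embedding. -/
def completion (X : SquaMS.{u}) : SquaMS.{u} where
  carrier := Completion X
  dist_le_two x y := by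
    induction x, y using Completion.induction_on₂ with
    | hp => exact isClosed_le continuous_dist continuous_const
    | ih a b => rw [Completion.dist_eq]; exact X.dist_le_two a b
  S p := (X.S p : Completion X)
  S_injective := fun p q h => X.S_injective (Completion.coe_injective _ h)
  sq₁_left r s := by rw [Completion.dist_eq]; exact X.sq₁_left r s
  sq₁_right r s := by rw [Completion.dist_eq]; exact X.sq₁_right r s
  sq₁_bottom r s := by rw [Completion.dist_eq]; exact X.sq₁_bottom r s
  sq₁_top r s := by rw [Completion.dist_eq]; exact X.sq₁_top r s
  sq₂ p q := by rw [Completion.dist_eq]; exact X.sq₂ p q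

/-- The Cauchy completion functor `C` on square metric spaces. -/
def completionFunctor : SquaMS.{u} ⥤ SquaMS.{u} where
  obj X := X.completion
  map {X Y} f :=
    { toFun := Completion.map f.toFun
      short := by
        have h := (Hom.lipschitz f).completion_map
        intro x y
        exact (h.dist_le_mul x y).trans_eq (one_mul _)
      map_S := fun p => by
        change Completion.map f.toFun (X.S p : Completion X) = (Y.S p : Completion Y)
        rw [Completion.map_coe (Hom.lipschitz f).uniformContinuous, f.map_S] }
  map_id X := by
    apply Hom.ext
    exact Completion.map_id
  map_comp {X Y Z} f g := by
    apply Hom.ext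
    exact (Completion.map_comp (Hom.lipschitz g).uniformContinuous
      (Hom.lipschitz f).uniformContinuous).symm

/-! ## The underlying set of `M ⊗ X` -/

/-- The index set `M = {0,1,2}² \ {(1,1)}`; `(i, j)` is the (column, row) of a cell of the
`3 × 3` grid. -/
abbrev Idx : Type := {m : Fin 3 × Fin 3 // m ≠ (1, 1)}

/-- Column of an index as a real number. -/
def Idx.col (m : Idx) : ℝ := (m.1.1 : ℕ)

/-- Row of an index as a real number. -/
def Idx.row (m : Idx) : ℝ := (m.1.2 : ℕ)

/-- The eight families of generating identifications on `M × M₀`. -/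
inductive E : Idx × SquareBoundary → Idx × SquareBoundary → Prop
  | e1 (r) : E (⟨(0, 0), by decide⟩, .top r) (⟨(0, 1), by decide⟩, .bottom r)
  | e2 (r) : E (⟨(0, 1), by decide⟩, .top r) (⟨(0, 2), by decide⟩, .bottom r)
  | e3 (r) : E (⟨(0, 2), by decide⟩, .right r) (⟨(1, 2), by decide⟩, .left r)
  | e4 (r) : E (⟨(1, 2), by decide⟩, .right r) (⟨(2, 2), by decide⟩, .left r)
  | e5 (r) : E (⟨(2, 2), by decide⟩, .bottom r) (⟨(2, 1), by decide⟩, .top r)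
  | e6 (r) : E (⟨(2, 1), by decide⟩, .bottom r) (⟨(2, 0), by decide⟩, .top r)
  | e7 (r) : E (⟨(2, 0), by decide⟩, .left r) (⟨(1, 0), by decide⟩, .right r)
  | e8 (r) : E (⟨(1, 0), by decide⟩, .left r) (⟨(0, 0), by decide⟩, .right r)

variable (X Y : SquaMS.{u})

/-- The relation on `M × X` induced by `E`. -/
def Glue (a b : Idx × X) : Prop :=
  ∃ p q : SquareBoundary, E (a.1, p) (b.1, q) ∧ a.2 = X.S p ∧ b.2 = X.S q

/-- The equivalence relation on `M × X` generated by the identifications. -/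
def glueSetoid : Setoid (Idx × X) := Relation.EqvGen.setoid (Glue X)

/-- The metric on `M × X`: scaled by `1/3` in each copy of `X`, and `2` between different
copies. -/
def prodDist (a b : Idx × X) : ℝ := if a.1 = b.1 then dist a.2 b.2 / 3 else 2

open Classical in
/-- The contribution of a pair of consecutive points of a path to its score: identified
points count `0`. -/
def stepScore (a b : Idx × X) : ℝ := if glueSetoid X a b then 0 else prodDist X a b

/-- The score of the finite path from `a` to `b` through the given list of intermediate points
of `M × X`. -/
def score : Idx × X → List (Idx × X) → Idx × X → ℝ
  | a, [], b => stepScore X a b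
  | a, c :: l, b => stepScore X a c + score c l b

/-- The infimum of the scores of all finite paths from `a` to `b` in `M × X`. -/
def pathDist (a b : Idx × X) : ℝ := ⨅ l : List (Idx × X), score X a l b

/-- The underlying set of `M ⊗ X`. -/
def Tensor : Type u := Quotient (glueSetoid X)

variable {X Y}

/-- The class `m ⊗ x`. -/
def tmk (a : Idx × X) : Tensor X := Quotient.mk (glueSetoid X) a

/-! ### The path pseudometric -/

theorem prodDist_nonneg (a b : Idx × X) : 0 ≤ prodDist X a b := by
  unfold prodDist; split_ifs <;> positivity

theorem prodDist_le (a b : Idx × X) : prodDist X a b ≤ 2 := by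
  unfold prodDist; split_ifs
  · linarith [X.dist_le_two a.2 b.2]
  · exact le_rfl

theorem prodDist_comm (a b : Idx × X) : prodDist X a b = prodDist X b a := by
  unfold prodDist; rw [dist_comm]; simp only [eq_comm]

theorem stepScore_nonneg (a b : Idx × X) : 0 ≤ stepScore X a b := by
  unfold stepScore; split_ifs
  · exact le_rfl
  · exact prodDist_nonneg a b

theorem stepScore_le (a b : Idx × X) : stepScore X a b ≤ prodDist X a b := by
  unfold stepScore; split_ifs
  · exact prodDist_nonneg a b
  · exact le_rfl

theorem stepScore_comm (a b : Idx × X) : stepScore X a b = stepScore X b a := by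
  unfold stepScore
  rw [prodDist_comm, (glueSetoid X).comm']

theorem stepScore_eq_zero {a b : Idx × X} (h : glueSetoid X a b) : stepScore X a b = 0 := by
  unfold stepScore; rw [if_pos h]

theorem score_nonneg (a : Idx × X) (l : List (Idx × X)) (b : Idx × X) :
    0 ≤ score X a l b := by
  induction l generalizing a with
  | nil => exact stepScore_nonneg a b
  | cons c l ih => exact add_nonneg (stepScore_nonneg a c) (ih c)

theorem score_append (a : Idx × X) (l : List (Idx × X)) (b : Idx × X) (l' : List (Idx × X))
    (c : Idx × X) : score X a (l ++ b :: l') c = score X a l b + score X b l' c := by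
  induction l generalizing a with
  | nil => rfl
  | cons d l ih => simp only [List.cons_append, score, ih, add_assoc]

theorem score_reverse (a : Idx × X) (l : List (Idx × X)) (b : Idx × X) :
    score X b l.reverse a = score X a l b := by
  induction l generalizing a with
  | nil => exact stepScore_comm b a
  | cons c l ih =>
    rw [List.reverse_cons, score_append, ih c]
    simp only [score]
    rw [stepScore_comm c a, add_comm]

theorem bddBelow_score (a b : Idx × X) :
    BddBelow (Set.range fun l : List (Idx × X) => score X a l b) :=
  ⟨0, by rintro _ ⟨l, rfl⟩; exact score_nonneg a l b⟩

theorem pathDist_le_score (a : Idx × X) (l : List (Idx × X)) (b : Idx × X) :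
    pathDist X a b ≤ score X a l b := ciInf_le (bddBelow_score a b) l

theorem pathDist_le_step (a b : Idx × X) : pathDist X a b ≤ stepScore X a b :=
  pathDist_le_score a [] b

theorem pathDist_nonneg (a b : Idx × X) : 0 ≤ pathDist X a b :=
  le_ciInf fun l => score_nonneg a l b

theorem pathDist_comm (a b : Idx × X) : pathDist X a b = pathDist X b a := by
  apply le_antisymm <;> refine le_ciInf fun l => ?_
  · rw [← score_reverse]; exact pathDist_le_score _ _ _
  · rw [← score_reverse]; exact pathDist_le_score _ _ _

theorem pathDist_triangle (a b c : Idx × X) :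
    pathDist X a c ≤ pathDist X a b + pathDist X b c := by
  have h1 : ∀ l' : List (Idx × X), pathDist X a c - score X b l' c ≤ pathDist X a b := by
    intro l'
    refine le_ciInf fun l => ?_
    have := pathDist_le_score a (l ++ b :: l') c
    rw [score_append] at this
    linarith
  have h2 : pathDist X a c - pathDist X a b ≤ pathDist X b c :=
    le_ciInf fun l' => by linarith [h1 l']
  linarith

theorem pathDist_eq_zero {a b : Idx × X} (h : glueSetoid X a b) : pathDist X a b = 0 :=
  le_antisymm ((pathDist_le_step a b).trans (stepScore_eq_zero h).le) (pathDist_nonneg a b)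

theorem pathDist_congr {a b a' b' : Idx × X} (ha : glueSetoid X a a')
    (hb : glueSetoid X b b') : pathDist X a b = pathDist X a' b' := by
  have h1 := pathDist_triangle a a' b
  have h2 := pathDist_triangle a' b' b
  have h3 := pathDist_triangle a' a b'
  have h4 := pathDist_triangle a b b'
  rw [pathDist_eq_zero ha] at h1
  rw [pathDist_eq_zero ((glueSetoid X).symm' hb)] at h2
  rw [pathDist_eq_zero ((glueSetoid X).symm' ha)] at h3
  rw [pathDist_eq_zero hb] at h4
  linarith

/-- A map on `M × X` that respects the generating identifications respects the generated
equivalence relation. -/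
theorem respects {Z : Type*} (F : Idx × X → Z) (hF : ∀ a b, Glue X a b → F a = F b)
    {a b : Idx × X} (h : glueSetoid X a b) : F a = F b := by
  replace h : Relation.EqvGen (Glue X) a b := h
  induction h with
  | rel a b h => exact hF a b h
  | refl => rfl
  | symm a b h ih => exact ih.symm
  | trans a b c h1 h2 ih1 ih2 => exact ih1.trans ih2

/-- A map on `M × X` that respects the identifications and is short for the metric of `M × X` is
short for the path metric. -/
theorem short_of_prodDist {Z : Type*} [PseudoMetricSpace Z] (F : Idx × X → Z)
    (hF : ∀ a b, Glue X a b → F a = F b)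
    (hd : ∀ a b, dist (F a) (F b) ≤ prodDist X a b) (a b : Idx × X) :
    dist (F a) (F b) ≤ pathDist X a b := by
  have hs : ∀ a b, dist (F a) (F b) ≤ stepScore X a b := by
    intro a b
    unfold stepScore
    split_ifs with h
    · rw [respects F hF h, dist_self]
    · exact hd a b
  refine le_ciInf fun l => ?_
  induction l generalizing a with
  | nil => exact hs a b
  | cons c l ih => exact (dist_triangle _ (F c) _).trans (add_le_add (hs a c) (ih c))

/-! ### Boundary points and their positions in the `3 × 3` grid -/

theorem E_pos {a b : Idx × SquareBoundary} (h : E a b) :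
    a.1.col + a.2.fst = b.1.col + b.2.fst ∧ a.1.row + a.2.snd = b.1.row + b.2.snd := by
  cases h <;>
    simp [Idx.col, Idx.row, SquareBoundary.fst, SquareBoundary.snd, SquareBoundary.left,
      SquareBoundary.right, SquareBoundary.top, SquareBoundary.bottom] <;> norm_num

theorem glue_vert {m n : Idx} {p q : SquareBoundary} (hc : m.1.1 = n.1.1)
    (hr : (m.1.2 : ℕ) + 1 = n.1.2) (hp : p.snd = 1) (hq : q.snd = 0) (h : p.fst = q.fst) :
    glueSetoid X (m, X.S p) (n, X.S q) := by
  have hq' : q = .bottom ⟨p.fst, p.fst_mem⟩ := SquareBoundary.ext' h.symm hq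
  have cases : ∀ m n : Fin 3 × Fin 3, m ≠ (1, 1) → n ≠ (1, 1) → m.1 = n.1 →
      (m.2 : ℕ) + 1 = (n.2 : ℕ) →
      (m = (0, 0) ∧ n = (0, 1)) ∨
      (m = (0, 1) ∧ n = (0, 2)) ∨
      (m = (2, 1) ∧ n = (2, 2)) ∨
      (m = (2, 0) ∧ n = (2, 1)) := by decide
  have key : E (m, p) (n, q) ∨ E (n, q) (m, p) := by
    rw [hq', SquareBoundary.eq_top hp]
    obtain ⟨m, hm⟩ := m
    obtain ⟨n, hn⟩ := n
    rcases cases _ _ hm hn hc hr with ⟨e, e'⟩ | ⟨e, e'⟩ | ⟨e, e'⟩ | ⟨e, e'⟩ <;>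
      (subst e; subst e')
    · exact Or.inl (E.e1 _)
    · exact Or.inl (E.e2 _)
    · exact Or.inr (E.e5 _)
    · exact Or.inr (E.e6 _)
  rcases key with h | h
  · exact .rel _ _ ⟨p, q, h, rfl, rfl⟩
  · exact .symm _ _ (.rel _ _ ⟨q, p, h, rfl, rfl⟩)

theorem glue_horiz {m n : Idx} {p q : SquareBoundary} (hc : m.1.2 = n.1.2)
    (hr : (m.1.1 : ℕ) + 1 = n.1.1) (hp : p.fst = 1) (hq : q.fst = 0) (h : p.snd = q.snd) :
    glueSetoid X (m, X.S p) (n, X.S q) := by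
  have hq' : q = .left ⟨p.snd, p.snd_mem⟩ := SquareBoundary.ext' hq h.symm
  have cases : ∀ m n : Fin 3 × Fin 3, m ≠ (1, 1) → n ≠ (1, 1) → m.2 = n.2 →
      (m.1 : ℕ) + 1 = (n.1 : ℕ) →
      (m = (0, 2) ∧ n = (1, 2)) ∨
      (m = (1, 2) ∧ n = (2, 2)) ∨
      (m = (1, 0) ∧ n = (2, 0)) ∨
      (m = (0, 0) ∧ n = (1, 0)) := by decide
  have key : E (m, p) (n, q) ∨ E (n, q) (m, p) := by
    rw [hq', SquareBoundary.eq_right hp]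
    obtain ⟨m, hm⟩ := m
    obtain ⟨n, hn⟩ := n
    rcases cases _ _ hm hn hc hr with ⟨e, e'⟩ | ⟨e, e'⟩ | ⟨e, e'⟩ | ⟨e, e'⟩ <;>
      (subst e; subst e')
    · exact Or.inl (E.e3 _)
    · exact Or.inl (E.e4 _)
    · exact Or.inr (E.e7 _)
    · exact Or.inr (E.e8 _)
  rcases key with h | h
  · exact .rel _ _ ⟨p, q, h, rfl, rfl⟩
  · exact .symm _ _ (.rel _ _ ⟨q, p, h, rfl, rfl⟩)

/-- A coordinate comparison: two unit intervals `[i, i+1]`, `[k, k+1]` meeting in a point. -/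
theorem coord_cases {i k : Fin 3} {a b : ℝ} (ha0 : 0 ≤ a) (ha1 : a ≤ 1) (hb0 : 0 ≤ b)
    (hb1 : b ≤ 1) (h : ((i : ℕ) : ℝ) + a = ((k : ℕ) : ℝ) + b) :
    (i = k ∧ a = b) ∨ ((i : ℕ) + 1 = k ∧ a = 1 ∧ b = 0) ∨
      ((k : ℕ) + 1 = i ∧ b = 1 ∧ a = 0) := by
  rcases lt_trichotomy (i : ℕ) (k : ℕ) with hlt | heq | hlt
  · have h1 : ((i : ℕ) : ℝ) + 1 ≤ ((k : ℕ) : ℝ) := by exact_mod_cast hlt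
    refine Or.inr (Or.inl ⟨?_, by linarith, by linarith⟩)
    have h2 : ((k : ℕ) : ℝ) = ((i : ℕ) : ℝ) + 1 := by linarith
    have h3 : (k : ℕ) = (i : ℕ) + 1 := by exact_mod_cast h2
    exact h3.symm
  · refine Or.inl ⟨Fin.ext heq, ?_⟩
    rw [heq] at h; linarith
  · have h1 : ((k : ℕ) : ℝ) + 1 ≤ ((i : ℕ) : ℝ) := by exact_mod_cast hlt
    refine Or.inr (Or.inr ⟨?_, by linarith, by linarith⟩)
    have h2 : ((i : ℕ) : ℝ) = ((k : ℕ) : ℝ) + 1 := by linarith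
    have h3 : (i : ℕ) = (k : ℕ) + 1 := by exact_mod_cast h2
    exact h3.symm

/-- Two cells that meet in a corner only: their common corner is identified. -/
theorem glue_diag {m n : Idx} {p q : SquareBoundary}
    (h1 : (m.1.1 : ℕ) + 1 = n.1.1) (hp1 : p.fst = 1) (hq1 : q.fst = 0)
    (h2 : ((m.1.2 : ℕ) + 1 = n.1.2 ∧ p.snd = 1 ∧ q.snd = 0) ∨
      ((n.1.2 : ℕ) + 1 = m.1.2 ∧ q.snd = 1 ∧ p.snd = 0)) :
    glueSetoid X (m, X.S p) (n, X.S q) := by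
  -- one of the two cells adjacent to both is not the central one
  by_cases hc : (m.1.1, n.1.2) = ((1, 1) : Fin 3 × Fin 3)
  · have hc' : (n.1.1, m.1.2) ≠ ((1, 1) : Fin 3 × Fin 3) := by
      intro h
      have e1 := congrArg (fun t : Fin 3 × Fin 3 => (t.1 : ℕ)) hc
      have e2 := congrArg (fun t : Fin 3 × Fin 3 => (t.1 : ℕ)) h
      simp only at e1 e2
      omega
    let k : Idx := ⟨(n.1.1, m.1.2), hc'⟩
    let s : SquareBoundary := .left ⟨p.snd, p.snd_mem⟩
    refine (glueSetoid X).trans' (y := (k, X.S s)) (glue_horiz rfl h1 hp1 rfl rfl) ?_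
    rcases h2 with ⟨ha, hb, hd⟩ | ⟨ha, hb, hd⟩
    · exact glue_vert rfl ha hb hd hq1.symm
    · exact (glueSetoid X).symm' (glue_vert rfl ha hb hd hq1)
  · let k : Idx := ⟨(m.1.1, n.1.2), hc⟩
    let s : SquareBoundary := .right ⟨q.snd, q.snd_mem⟩
    refine (glueSetoid X).trans' (y := (k, X.S s)) ?_ (glue_horiz rfl h1 rfl hq1 rfl)
    rcases h2 with ⟨ha, hb, hd⟩ | ⟨ha, hb, hd⟩
    · exact glue_vert rfl ha hb hd hp1
    · exact (glueSetoid X).symm' (glue_vert rfl ha hb hd hp1.symm)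

/-- Boundary points with the same position in the grid are identified. -/
theorem glue_of_pos {m n : Idx} {p q : SquareBoundary}
    (h1 : m.col + p.fst = n.col + q.fst) (h2 : m.row + p.snd = n.row + q.snd) :
    glueSetoid X (m, X.S p) (n, X.S q) := by
  have c1 := coord_cases p.fst_nonneg p.fst_le q.fst_nonneg q.fst_le h1
  have c2 := coord_cases p.snd_nonneg p.snd_le q.snd_nonneg q.snd_le h2
  rcases c1 with ⟨a1, b1⟩ | ⟨a1, b1, d1⟩ | ⟨a1, b1, d1⟩
  · rcases c2 with ⟨a2, b2⟩ | ⟨a2, b2, d2⟩ | ⟨a2, b2, d2⟩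
    · have e1 : m = n := Subtype.ext (Prod.ext a1 a2)
      have e2 : p = q := SquareBoundary.ext' b1 b2
      rw [e1, e2]
    · exact glue_vert a1 a2 b2 d2 b1
    · exact (glueSetoid X).symm' (glue_vert a1.symm a2 b2 d2 b1.symm)
  · rcases c2 with ⟨a2, b2⟩ | c2 | c2
    · exact glue_horiz a2 a1 b1 d1 b2
    · exact glue_diag a1 b1 d1 (Or.inl c2)
    · exact glue_diag a1 b1 d1 (Or.inr c2)
  · rcases c2 with ⟨a2, b2⟩ | c2 | c2
    · exact (glueSetoid X).symm' (glue_horiz a2.symm a1 b1 d1 b2.symm)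
    · exact (glueSetoid X).symm' (glue_diag a1 b1 d1 (Or.inr c2))
    · exact (glueSetoid X).symm' (glue_diag a1 b1 d1 (Or.inl c2))

/-! ### Lower bounds for the path metric -/

theorem exists_extension (φ : SquareBoundary → ℝ) (lo : ℝ)
    (hφ : ∀ p q, |φ p - φ q| ≤ |p.fst - q.fst| + |p.snd - q.snd|)
    (hlo : ∀ p, lo ≤ φ p ∧ φ p ≤ lo + 2) :
    ∃ g : X → ℝ, (∀ x y, |g x - g y| ≤ dist x y) ∧ (∀ x, lo ≤ g x ∧ g x ≤ lo + 2) ∧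
      ∀ p, g (X.S p) = φ p := by
  let f : X → ℝ := Function.extend X.S φ 0
  have hf : ∀ p, f (X.S p) = φ p := fun p => X.S_injective.extend_apply φ 0 p
  have hl : LipschitzOnWith 1 f (Set.range X.S) := by
    refine LipschitzOnWith.of_dist_le_mul ?_
    rintro _ ⟨p, rfl⟩ _ ⟨q, rfl⟩
    rw [hf, hf, Real.dist_eq, NNReal.coe_one, one_mul]
    exact (hφ p q).trans (X.sq₂ p q)
  obtain ⟨g, hg, hfg⟩ := hl.extend_real
  refine ⟨fun x => max lo (min (g x) (lo + 2)), ?_, ?_, ?_⟩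
  · intro x y
    have h1 : |g x - g y| ≤ dist x y := by
      have := hg.dist_le_mul x y
      simpa [Real.dist_eq] using this
    refine (abs_max_sub_max_le_max _ _ _ _).trans ?_
    rw [sub_self, abs_zero]
    refine max_le dist_nonneg ((abs_min_sub_min_le_max _ _ _ _).trans ?_)
    rw [sub_self, abs_zero]
    exact max_le h1 dist_nonneg
  · intro x
    exact ⟨le_max_left _ _, max_le (by linarith) (min_le_right _ _)⟩
  · intro p
    have h1 : g (X.S p) = φ p := by rw [← hf p, hfg ⟨p, rfl⟩]
    obtain ⟨h2, h3⟩ := hlo p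
    simp only [h1, min_eq_left h3, max_eq_right h2]

theorem Idx.bounds (m : Idx) : 0 ≤ m.col ∧ m.col ≤ 2 ∧ 0 ≤ m.row ∧ m.row ≤ 2 := by
  have h1 : (m.1.1 : ℕ) ≤ 2 := by omega
  have h2 : (m.1.2 : ℕ) ≤ 2 := by omega
  refine ⟨Nat.cast_nonneg _, ?_, Nat.cast_nonneg _, ?_⟩
  · unfold Idx.col; exact_mod_cast h1
  · unfold Idx.row; exact_mod_cast h2

theorem pathDist_lower (a b : Idx → ℝ) (φ : SquareBoundary → ℝ) (lo : ℝ)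
    (hφ : ∀ p q, |φ p - φ q| ≤ |p.fst - q.fst| + |p.snd - q.snd|)
    (hlo : ∀ p, lo ≤ φ p ∧ φ p ≤ lo + 2)
    (ha : ∀ m, b m = a m + 2 * lo ∧ 0 ≤ a m ∧ a m ≤ 4)
    (hE : ∀ m n p q, E (m, p) (n, q) → b m + φ p = b n + φ q)
    (m n : Idx) (p q : SquareBoundary) :
    |(b m + φ p) / 3 - (b n + φ q) / 3| ≤ pathDist X (m, X.S p) (n, X.S q) := by
  obtain ⟨g, hg, hb, hS⟩ := exists_extension (X := X) φ lo hφ hlo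
  have := short_of_prodDist (X := X) (fun c => (b c.1 + g c.2) / 3) ?_ ?_ (m, X.S p) (n, X.S q)
  · simpa only [Real.dist_eq, hS] using this
  · rintro ⟨m, x⟩ ⟨n, y⟩ ⟨p, q, h, hx, hy⟩
    simp only at hx hy h ⊢
    rw [hx, hy, hS, hS, hE _ _ _ _ h]
  · rintro ⟨m, x⟩ ⟨n, y⟩
    unfold prodDist
    simp only [Real.dist_eq]
    split_ifs with h
    · subst h
      rw [← sub_div, abs_div, abs_of_pos (by norm_num : (0 : ℝ) < 3), add_sub_add_left_eq_sub]
      linarith [hg x y]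
    · have h1 := ha m
      have h2 := ha n
      have h3 := hb x
      have h4 := hb y
      rw [abs_le]
      constructor <;> linarith [h1.1, h1.2.1, h1.2.2, h2.1, h2.2.1, h2.2.2, h3.1, h3.2, h4.1, h4.2]

/-- The path metric dominates the taxicab distance of the positions of boundary points. -/
theorem taxi_le_pathDist (m n : Idx) (p q : SquareBoundary) :
    |(m.col + p.fst) / 3 - (n.col + q.fst) / 3| + |(m.row + p.snd) / 3 - (n.row + q.snd) / 3| ≤
      pathDist X (m, X.S p) (n, X.S q) := by
  have hu := pathDist_lower (X := X) (fun m => m.col + m.row) (fun m => m.col + m.row)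
    (fun p => p.fst + p.snd) 0 ?_ ?_ ?_ ?_ m n p q
  · have hv := pathDist_lower (X := X) (fun m => m.col - m.row + 2) (fun m => m.col - m.row)
      (fun p => p.fst - p.snd) (-1) ?_ ?_ ?_ ?_ m n p q
    · rw [abs_le] at hu hv
      rcases abs_cases ((m.col + p.fst) / 3 - (n.col + q.fst) / 3) with h1 | h1 <;>
      rcases abs_cases ((m.row + p.snd) / 3 - (n.row + q.snd) / 3) with h2 | h2 <;>
      · rw [h1.1, h2.1]; linarith [hu.1, hu.2, hv.1, hv.2]
    · intro p q
      calc _ = |(p.fst - q.fst) - (p.snd - q.snd)| := by ring_nf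
        _ ≤ _ := abs_sub _ _
    · intro p
      have := p.fst_nonneg; have := p.fst_le; have := p.snd_nonneg; have := p.snd_le
      constructor <;> linarith
    · intro m
      obtain ⟨h1, h2, h3, h4⟩ := m.bounds
      refine ⟨by ring, by linarith, by linarith⟩
    · intro m n p q h
      obtain ⟨h1, h2⟩ := E_pos h
      simp only at h1 h2
      linarith
  · intro p q
    calc _ = |(p.fst - q.fst) + (p.snd - q.snd)| := by ring_nf
      _ ≤ _ := abs_add_le _ _
  · intro p
    have := p.fst_nonneg; have := p.fst_le; have := p.snd_nonneg; have := p.snd_le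
    constructor <;> linarith
  · intro m
    obtain ⟨h1, h2, h3, h4⟩ := m.bounds
    refine ⟨by ring, by linarith, by linarith⟩
  · intro m n p q h
    obtain ⟨h1, h2⟩ := E_pos h
    simp only at h1 h2
    linarith

theorem isClosed_range_S : IsClosed (Set.range X.S) := by
  have h : Set.range X.S = (Set.range fun r => X.S (.left r)) ∪ (Set.range fun r => X.S (.right r)) ∪
      ((Set.range fun r => X.S (.bottom r)) ∪ (Set.range fun r => X.S (.top r))) := by
    ext x
    constructor
    · rintro ⟨p, rfl⟩
      rcases p.2.2.2 with (h | h) | (h | h)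
      · exact Or.inl (Or.inl ⟨_, congrArg X.S (SquareBoundary.eq_left h).symm⟩)
      · exact Or.inl (Or.inr ⟨_, congrArg X.S (SquareBoundary.eq_right h).symm⟩)
      · exact Or.inr (Or.inl ⟨_, congrArg X.S (SquareBoundary.eq_bottom h).symm⟩)
      · exact Or.inr (Or.inr ⟨_, congrArg X.S (SquareBoundary.eq_top h).symm⟩)
    · rintro ((⟨r, rfl⟩ | ⟨r, rfl⟩) | (⟨r, rfl⟩ | ⟨r, rfl⟩)) <;> exact ⟨_, rfl⟩
  have hc : ∀ f : Set.Icc (0 : ℝ) 1 → X, (∀ r s, dist (f r) (f s) = |(s : ℝ) - r|) →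
      IsClosed (Set.range f) := by
    intro f hf
    have hi : Isometry f := Isometry.of_dist_eq fun r s => by
      rw [hf, Subtype.dist_eq, Real.dist_eq, abs_sub_comm]
    exact (isCompact_range hi.continuous).isClosed
  rw [h]
  exact ((hc _ X.sq₁_left).union (hc _ X.sq₁_right)).union
    ((hc _ X.sq₁_bottom).union (hc _ X.sq₁_top))

theorem eq_of_pathDist_of_interior {m n : Idx} {x y : X} (hx : x ∉ Set.range X.S)
    (h : pathDist X (m, x) (n, y) = 0) : m = n ∧ x = y := by
  classical
  have hne : (Set.range X.S).Nonempty :=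
    ⟨X.S (.left ⟨0, by simp⟩), Set.mem_range_self _⟩
  set δ := Metric.infDist x (Set.range X.S) with hδ
  have hpos : 0 < δ := (isClosed_range_S.notMem_iff_infDist_pos hne).1 hx
  have hδ2 : δ ≤ 2 := by
    obtain ⟨z, hz⟩ := hne
    exact (Metric.infDist_le_dist_of_mem hz).trans (X.dist_le_two x z)
  let F : Idx × X → ℝ := fun c => if c.1 = m then min δ (dist x c.2) / 3 else δ / 3
  have hFS : ∀ k p, F (k, X.S p) = δ / 3 := by
    intro k p
    change (if k = m then min δ (dist x (X.S p)) / 3 else δ / 3) = _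
    split_ifs
    · rw [min_eq_left (Metric.infDist_le_dist_of_mem (Set.mem_range_self p))]
    · rfl
  have hF0 : ∀ c, 0 ≤ F c ∧ F c ≤ δ / 3 := by
    intro c
    change 0 ≤ (if c.1 = m then min δ (dist x c.2) / 3 else δ / 3) ∧
      (if c.1 = m then min δ (dist x c.2) / 3 else δ / 3) ≤ δ / 3
    split_ifs
    · have h1 : 0 ≤ min δ (dist x c.2) := le_min hpos.le dist_nonneg
      have h2 := min_le_left δ (dist x c.2)
      constructor <;> linarith
    · exact ⟨by linarith, le_rfl⟩
  have key := short_of_prodDist (X := X) F ?_ ?_ (m, x) (n, y)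
  · rw [h] at key
    have h0 : F (m, x) = F (n, y) := dist_le_zero.1 key
    have h1 : F (m, x) = 0 := by
      change (if m = m then min δ (dist x x) / 3 else δ / 3) = 0
      rw [if_pos rfl, dist_self, min_eq_right hpos.le, zero_div]
    have h2 : (if n = m then min δ (dist x y) / 3 else δ / 3) = 0 := h0.symm.trans h1
    split_ifs at h2 with hnm
    · refine ⟨hnm.symm, ?_⟩
      rcases min_choice δ (dist x y) with h3 | h3
      · rw [h3] at h2; linarith
      · rw [h3] at h2; exact dist_eq_zero.1 (by linarith)
    · linarith
  · rintro ⟨k, z⟩ ⟨l, w⟩ ⟨p, q, -, hz, hw⟩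
    simp only at hz hw
    rw [hz, hw, hFS, hFS]
  · rintro ⟨k, z⟩ ⟨l, w⟩
    unfold prodDist
    simp only [Real.dist_eq]
    split_ifs with hkl
    · subst hkl
      change |(if k = m then min δ (dist x z) / 3 else δ / 3) -
        (if k = m then min δ (dist x w) / 3 else δ / 3)| ≤ _
      split_ifs
      · rw [← sub_div, abs_div, abs_of_pos (by norm_num : (0 : ℝ) < 3)]
        have h1 := abs_min_sub_min_le_max δ (dist x z) δ (dist x w)
        rw [sub_self, abs_zero] at h1
        have h2 : |dist x z - dist x w| ≤ dist z w := by
          rw [dist_comm x z, dist_comm x w]; exact abs_dist_sub_le z w x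
        have h3 := h1.trans (max_le dist_nonneg h2)
        linarith
      · rw [sub_self, abs_zero]; positivity
    · have h1 := hF0 (k, z)
      have h2 := hF0 (l, w)
      rw [abs_le]
      constructor <;> linarith [h1.1, h1.2, h2.1, h2.2]

theorem glue_of_pathDist {a b : Idx × X} (h : pathDist X a b = 0) : glueSetoid X a b := by
  obtain ⟨m, x⟩ := a
  obtain ⟨n, y⟩ := b
  by_cases hx : x ∈ Set.range X.S
  · by_cases hy : y ∈ Set.range X.S
    · obtain ⟨p, rfl⟩ := hx
      obtain ⟨q, rfl⟩ := hy
      have h1 := taxi_le_pathDist (X := X) m n p q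
      rw [h] at h1
      have h2 := abs_nonneg ((m.col + p.fst) / 3 - (n.col + q.fst) / 3)
      have h3 := abs_nonneg ((m.row + p.snd) / 3 - (n.row + q.snd) / 3)
      have h4 := abs_eq_zero.1 (le_antisymm (by linarith) h2)
      have h5 := abs_eq_zero.1 (le_antisymm (by linarith) h3)
      exact glue_of_pos (by linarith) (by linarith)
    · rw [pathDist_comm] at h
      obtain ⟨rfl, rfl⟩ := eq_of_pathDist_of_interior hy h
      exact (glueSetoid X).refl' _
  · obtain ⟨rfl, rfl⟩ := eq_of_pathDist_of_interior hx h
    exact (glueSetoid X).refl' _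

/-! ### `M ⊗ X` as a square metric space -/

/-- The quotient metric on `M ⊗ X`. -/
instance : MetricSpace (Tensor X) where
  dist s t := Quotient.lift₂ (pathDist X) (fun _ _ _ _ ha hb => pathDist_congr ha hb) s t
  dist_self := by rintro ⟨a⟩; exact pathDist_eq_zero ((glueSetoid X).refl' a)
  dist_comm := by rintro ⟨a⟩ ⟨b⟩; exact pathDist_comm a b
  dist_triangle := by rintro ⟨a⟩ ⟨b⟩ ⟨c⟩; exact pathDist_triangle a b c
  eq_of_dist_eq_zero := by
    rintro ⟨a⟩ ⟨b⟩ h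
    exact Quotient.sound (glue_of_pathDist h)

theorem dist_tmk (a b : Idx × X) : dist (tmk a) (tmk b) = pathDist X a b := rfl

theorem tmk_eq {a b : Idx × X} (h : glueSetoid X a b) : tmk a = tmk b := Quotient.sound h

theorem dist_tmk_le (a b : Idx × X) : dist (tmk a) (tmk b) ≤ prodDist X a b :=
  (pathDist_le_step a b).trans (stepScore_le a b)

theorem dist_tmk_same (m : Idx) (x y : X) : dist (tmk (m, x)) (tmk (m, y)) ≤ dist x y / 3 := by
  refine (dist_tmk_le _ _).trans (le_of_eq ?_)
  unfold prodDist; rw [if_pos rfl]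

/-- Index of the third of the unit interval that contains `r`. -/
def third (r : ℝ) : Fin 3 := if r ≤ 1 / 3 then 0 else if r ≤ 2 / 3 then 1 else 2

theorem third_spec {r : ℝ} (h0 : 0 ≤ r) (h1 : r ≤ 1) :
    0 ≤ 3 * r - (third r : ℕ) ∧ 3 * r - (third r : ℕ) ≤ 1 := by
  unfold third; split_ifs <;> norm_num <;> constructor <;> linarith

theorem third_zero : third 0 = 0 := by unfold third; norm_num
theorem third_one : third 1 = 2 := by unfold third; norm_num

/-- The cell of the `3 × 3` grid that contains a boundary point. -/
def cell (p : SquareBoundary) : Idx :=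
  ⟨(third p.fst, third p.snd), by
    intro h
    have e1 : third p.fst = 1 := congrArg Prod.fst h
    have e2 : third p.snd = 1 := congrArg Prod.snd h
    rcases p.2.2.2 with (h | h) | (h | h)
    · rw [show p.fst = 0 from h, third_zero] at e1; exact absurd e1 (by decide)
    · rw [show p.fst = 1 from h, third_one] at e1; exact absurd e1 (by decide)
    · rw [show p.snd = 0 from h, third_zero] at e2; exact absurd e2 (by decide)
    · rw [show p.snd = 1 from h, third_one] at e2; exact absurd e2 (by decide)⟩

/-- The position of a boundary point relative to its cell, rescaled by `3`. -/
def rel (p : SquareBoundary) : SquareBoundary :=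
  ⟨(3 * p.fst - (third p.fst : ℕ), 3 * p.snd - (third p.snd : ℕ)),
    third_spec p.fst_nonneg p.fst_le, third_spec p.snd_nonneg p.snd_le, by
    rcases p.2.2.2 with (h | h) | (h | h)
    · rw [show p.fst = 0 from h, third_zero]; simp
    · rw [show p.fst = 1 from h, third_one]; norm_num
    · rw [show p.snd = 0 from h, third_zero]; simp
    · rw [show p.snd = 1 from h, third_one]; norm_num⟩

theorem cell_rel (p : SquareBoundary) :
    (cell p).col + (rel p).fst = 3 * p.fst ∧ (cell p).row + (rel p).snd = 3 * p.snd := by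
  constructor
  · change ((third p.fst : ℕ) : ℝ) + (3 * p.fst - (third p.fst : ℕ)) = _
    ring
  · change ((third p.snd : ℕ) : ℝ) + (3 * p.snd - (third p.snd : ℕ)) = _
    ring

variable (X) in
/-- The boundary map of `M ⊗ X`: each side of `M ⊗ X` consists of three scaled copies of the
corresponding side of `X`. -/
def tensorS (p : SquareBoundary) : Tensor X := tmk (cell p, X.S (rel p))

/-- `tensorS p = m ⊗ S q` whenever `q` in the cell `m` has the position of `p`; so the choice of
the cell for the points `1/3` and `2/3` of a side is immaterial. -/
theorem tensorS_eq {p q : SquareBoundary} {m : Idx} (h1 : m.col + q.fst = 3 * p.fst)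
    (h2 : m.row + q.snd = 3 * p.snd) : tensorS X p = tmk (m, X.S q) :=
  tmk_eq (glue_of_pos (by rw [h1, (cell_rel p).1]) (by rw [h2, (cell_rel p).2]))

theorem tensorS_lower (p q : SquareBoundary) :
    |p.fst - q.fst| + |p.snd - q.snd| ≤ dist (tensorS X p) (tensorS X q) := by
  have h := taxi_le_pathDist (X := X) (cell p) (cell q) (rel p) (rel q)
  rw [(cell_rel p).1, (cell_rel p).2, (cell_rel q).1, (cell_rel q).2] at h
  rw [tensorS, tensorS, dist_tmk]
  convert h using 3 <;> ring

/-- A map on the unit interval that is short on each third is short. -/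
theorem short_of_thirds {Z : Type*} [PseudoMetricSpace Z] (f : Set.Icc (0 : ℝ) 1 → Z)
    (h : ∀ i : Fin 3, ∀ r s : Set.Icc (0 : ℝ) 1, ((i : ℕ) : ℝ) ≤ 3 * (r : ℝ) →
      3 * (r : ℝ) ≤ (i : ℕ) + 1 → ((i : ℕ) : ℝ) ≤ 3 * (s : ℝ) → 3 * (s : ℝ) ≤ (i : ℕ) + 1 →
      dist (f r) (f s) ≤ |(s : ℝ) - r|) (r s : Set.Icc (0 : ℝ) 1) :
    dist (f r) (f s) ≤ |(s : ℝ) - r| := by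
  wlog hrs : r ≤ s generalizing r s
  · rw [dist_comm, abs_sub_comm]; exact this s r (le_of_not_ge hrs)
  have hrs' : (r : ℝ) ≤ s := hrs
  have c0 : (((0 : Fin 3) : ℕ) : ℝ) = 0 := Nat.cast_zero
  have c1 : (((1 : Fin 3) : ℕ) : ℝ) = 1 := Nat.cast_one
  have c2 : (((2 : Fin 3) : ℕ) : ℝ) = 2 := Nat.cast_ofNat
  have h0 := h 0
  have h1 := h 1
  have h2 := h 2
  rw [c0] at h0
  rw [c1] at h1
  rw [c2] at h2
  let a : Set.Icc (0 : ℝ) 1 := ⟨1 / 3, by norm_num, by norm_num⟩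
  let b : Set.Icc (0 : ℝ) 1 := ⟨2 / 3, by norm_num, by norm_num⟩
  have ha : (a : ℝ) = 1 / 3 := rfl
  have hb : (b : ℝ) = 2 / 3 := rfl
  have step : ∀ (c : Set.Icc (0 : ℝ) 1), (r : ℝ) ≤ c → (c : ℝ) ≤ s →
      dist (f r) (f c) ≤ |(c : ℝ) - r| → dist (f c) (f s) ≤ |(s : ℝ) - c| →
      dist (f r) (f s) ≤ |(s : ℝ) - r| := by
    intro c hc1 hc2 hd1 hd2
    rw [abs_of_nonneg (by linarith)] at hd1 hd2 ⊢
    linarith [dist_triangle (f r) (f c) (f s)]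
  have r0 := r.2.1
  have s1 := s.2.2
  -- first the pairs in the last two thirds
  have main : ∀ r s : Set.Icc (0 : ℝ) 1, (r : ℝ) ≤ s → 1 ≤ 3 * (r : ℝ) →
      dist (f r) (f s) ≤ |(s : ℝ) - r| := by
    intro r s hrs hr
    have s1 := s.2.2
    by_cases hs : 3 * (s : ℝ) ≤ 2
    · exact h1 r s hr (by linarith) (by linarith) (by linarith)
    · by_cases hr2 : 2 ≤ 3 * (r : ℝ)
      · exact h2 r s hr2 (by linarith) (by linarith) (by linarith)
      · have e1 := h1 r b hr (by linarith) (by rw [hb]; norm_num)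
          (by rw [hb]; norm_num)
        have e2 := h2 b s (by rw [hb]; norm_num) (by rw [hb]; norm_num)
          (by linarith) (by linarith)
        rw [abs_of_nonneg (by rw [hb]; linarith)] at e1 e2
        rw [abs_of_nonneg (by linarith)]
        linarith [dist_triangle (f r) (f b) (f s)]
  by_cases hr : 1 ≤ 3 * (r : ℝ)
  · exact main r s hrs' hr
  · by_cases hs : 3 * (s : ℝ) ≤ 1
    · exact h0 r s (by linarith) (by linarith) (by linarith) (by linarith)
    · refine step a (by rw [ha]; linarith) (by rw [ha]; linarith) ?_
        (main a s (by rw [ha]; linarith) (by rw [ha]; norm_num))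
      exact h0 r a (by linarith) (by linarith) (by rw [ha]; norm_num) (by rw [ha]; norm_num)

theorem tensorS_side_le (side : Set.Icc (0 : ℝ) 1 → SquareBoundary)
    (hside : ∀ r s, dist (X.S (side r)) (X.S (side s)) = |(s : ℝ) - r|) (idx : Fin 3 → Idx)
    (h : ∀ i : Fin 3, ∀ r t : Set.Icc (0 : ℝ) 1, ((i : ℕ) : ℝ) + t = 3 * r →
      (idx i).col + (side t).fst = 3 * (side r).fst ∧
      (idx i).row + (side t).snd = 3 * (side r).snd)
    (r s : Set.Icc (0 : ℝ) 1) :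
    dist (tensorS X (side r)) (tensorS X (side s)) ≤ |(s : ℝ) - r| := by
  refine short_of_thirds (fun r => tensorS X (side r)) ?_ r s
  intro i r s hr1 hr2 hs1 hs2
  let r' : Set.Icc (0 : ℝ) 1 := ⟨3 * r - (i : ℕ), by linarith, by linarith⟩
  let s' : Set.Icc (0 : ℝ) 1 := ⟨3 * s - (i : ℕ), by linarith, by linarith⟩
  have hr := h i r r' (add_sub_cancel _ _)
  have hs := h i s s' (add_sub_cancel _ _)
  change dist (tensorS X (side r)) (tensorS X (side s)) ≤ _
  rw [tensorS_eq hr.1 hr.2, tensorS_eq hs.1 hs.2]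
  refine (dist_tmk_same _ _ _).trans (le_of_eq ?_)
  rw [hside]
  have e : (s' : ℝ) - r' = 3 * ((s : ℝ) - r) := by
    change 3 * (s : ℝ) - (i : ℕ) - (3 * (r : ℝ) - (i : ℕ)) = _
    ring
  rw [e, abs_mul, abs_of_pos (by norm_num : (0 : ℝ) < 3)]
  ring

variable (X) in
/-- The square metric space `M ⊗ X`. -/
def tensor : SquaMS.{u} where
  carrier := Tensor X
  dist_le_two := by
    rintro ⟨a⟩ ⟨b⟩
    exact (dist_tmk_le a b).trans (prodDist_le a b)
  S := tensorS X
  S_injective := by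
    intro p q h
    have h1 := tensorS_lower (X := X) p q
    rw [h, dist_self] at h1
    have h2 := abs_nonneg (p.fst - q.fst)
    have h3 := abs_nonneg (p.snd - q.snd)
    have h4 := abs_eq_zero.1 (le_antisymm (by linarith) h2)
    have h5 := abs_eq_zero.1 (le_antisymm (by linarith) h3)
    exact SquareBoundary.ext' (sub_eq_zero.1 h4) (sub_eq_zero.1 h5)
  sq₁_left r s := by
    refine le_antisymm (tensorS_side_le _ X.sq₁_left
      (fun i => ⟨(0, i), by simp⟩) ?_ r s) ?_
    · intro i r t h
      simpa [Idx.col, Idx.row, SquareBoundary.left, SquareBoundary.fst, SquareBoundary.snd] using h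
    · have := tensorS_lower (X := X) (.left r) (.left s)
      simpa [SquareBoundary.left, SquareBoundary.fst, SquareBoundary.snd,
        abs_sub_comm (r : ℝ) s] using this
  sq₁_right r s := by
    refine le_antisymm (tensorS_side_le _ X.sq₁_right
      (fun i => ⟨(2, i), by simp⟩) ?_ r s) ?_
    · intro i r t h
      refine ⟨?_, h⟩
      change ((2 : ℕ) : ℝ) + 1 = 3 * 1
      norm_num
    · have := tensorS_lower (X := X) (.right r) (.right s)
      simpa [SquareBoundary.right, SquareBoundary.fst, SquareBoundary.snd,
        abs_sub_comm (r : ℝ) s] using this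
  sq₁_bottom r s := by
    refine le_antisymm (tensorS_side_le _ X.sq₁_bottom
      (fun i => ⟨(i, 0), by simp⟩) ?_ r s) ?_
    · intro i r t h
      simpa [Idx.col, Idx.row, SquareBoundary.bottom, SquareBoundary.fst,
        SquareBoundary.snd] using h
    · have := tensorS_lower (X := X) (.bottom r) (.bottom s)
      simpa [SquareBoundary.bottom, SquareBoundary.fst, SquareBoundary.snd,
        abs_sub_comm (r : ℝ) s] using this
  sq₁_top r s := by
    refine le_antisymm (tensorS_side_le _ X.sq₁_top
      (fun i => ⟨(i, 2), by simp⟩) ?_ r s) ?_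
    · intro i r t h
      refine ⟨h, ?_⟩
      change ((2 : ℕ) : ℝ) + 1 = 3 * 1
      norm_num
    · have := tensorS_lower (X := X) (.top r) (.top s)
      simpa [SquareBoundary.top, SquareBoundary.fst, SquareBoundary.snd,
        abs_sub_comm (r : ℝ) s] using this
  sq₂ p q := tensorS_lower p q

/-- The morphism `M ⊗ X ⟶ Z` induced by a map on `M × X` that respects the identifications and
the boundary and is short for the metric of `M × X`. -/
def tensorDesc {Z : SquaMS.{u}} (F : Idx × X → Z)
    (hF : ∀ a b, Glue X a b → F a = F b)
    (hd : ∀ a b, dist (F a) (F b) ≤ prodDist X a b)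
    (hS : ∀ p, F (cell p, X.S (rel p)) = Z.S p) : X.tensor ⟶ Z where
  toFun := Quotient.lift F fun _ _ h => respects F hF h
  short := by rintro ⟨a⟩ ⟨b⟩; exact short_of_prodDist F hF hd a b
  map_S p := hS p

/-- The functor `M ⊗ -` on square metric spaces; on morphisms, `m ⊗ x ↦ m ⊗ f x`. -/
def tensorFunctor : SquaMS.{u} ⥤ SquaMS.{u} where
  obj X := X.tensor
  map {X Y} f := tensorDesc (Z := Y.tensor) (fun a => tmk (a.1, f.toFun a.2))
    (by
      rintro ⟨m, x⟩ ⟨n, y⟩ ⟨p, q, h, hx, hy⟩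
      simp only at hx hy
      rw [hx, hy]
      refine tmk_eq (.rel _ _ ⟨p, q, h, ?_, ?_⟩)
      · exact f.map_S p
      · exact f.map_S q)
    (by
      intro a b
      refine (dist_tmk_le _ _).trans ?_
      unfold prodDist
      split_ifs
      · linarith [f.short a.2 b.2]
      · exact le_rfl)
    (fun p => congrArg (fun y => tmk (cell p, y)) (f.map_S (rel p)))
  map_id X := by
    apply Hom.ext
    funext t
    obtain ⟨a⟩ := t
    rfl
  map_comp f g := by
    apply Hom.ext
    funext t
    obtain ⟨a⟩ := t
    rfl

variable (X) in
/-- The canonical comparison morphism `δ : M ⊗ C(X) ⟶ C(M ⊗ X)`, which sends `m ⊗ lim xₖ` to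
`lim (m ⊗ xₖ)`. -/
def comparison : tensorFunctor.obj (completionFunctor.obj X) ⟶
    completionFunctor.obj (tensorFunctor.obj X) :=
  have hl : ∀ m : Idx, LipschitzWith (1 / 3) fun x : X => tmk (m, x) := fun m =>
    LipschitzWith.of_dist_le_mul fun x y => (dist_tmk_same m x y).trans (le_of_eq (by
      push_cast; ring))
  have hc : ∀ (m : Idx) (x : X), Completion.map (fun x : X => (tmk (m, x) : Tensor X))
      (x : Completion X) = ((tmk (m, x) : Tensor X) : Completion (Tensor X)) := fun m x =>
    Completion.map_coe (hl m).uniformContinuous x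
  tensorDesc (X := X.completion) (Z := X.tensor.completion)
    (fun a => Completion.map (fun x : X => (tmk (a.1, x) : Tensor X)) a.2)
    (by
      rintro ⟨m, x⟩ ⟨n, y⟩ ⟨p, q, h, hx, hy⟩
      simp only at hx hy
      rw [hx, hy]
      refine (hc m (X.S p)).trans (Eq.trans ?_ (hc n (X.S q)).symm)
      exact congrArg _ (tmk_eq (.rel _ _ ⟨p, q, h, rfl, rfl⟩)))
    (by
      rintro ⟨m, x⟩ ⟨n, y⟩
      unfold prodDist
      split_ifs with h
      · simp only at h
        subst h
        have e : ∀ t : ℝ, ((1 / 3 : NNReal) : ℝ) * t = t / 3 := fun t => by push_cast; ring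
        exact ((hl m).completion_map.dist_le_mul x y).trans (le_of_eq (e _))
      · exact X.tensor.completion.dist_le_two _ _)
    (fun p => hc (cell p) (X.S (rel p)))

end SquaMS

end

/-!
The closed terms `m₁ ⊗ (m₂ ⊗ ⋯ ⊗ S p)`, with the largest distance of their values in an algebra,
form the initial algebra. Since `m ⊗ -` is injective with a Lipschitz inverse, `M ⊗ X` is complete
when `X` is, so `δ`, which is isometric with dense image, is an isomorphism.

It remains to see that a complete fixed point of `M ⊗ -` is a final coalgebra. For a coalgebra `β`
and a complete algebra `α`, the map `h ↦ α ∘ (M ⊗ h) ∘ β` contracts the space of all maps that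
preserve the boundary, short or not, so it has exactly one fixed point. The fixed point is short
because each application shrinks the defect of shortness, as soon as the distances between boundary
points in the algebra are at most those in the coalgebra. This matters only for points of opposite
sides. At the end points of the Cantor set an algebra has paths of length one between opposite
sides. In a coalgebra every path has to make a detour via such an end point.
-/

noncomputable section

namespace SquareBoundary

@[simp] theorem fst_left (r) : (left r).fst = 0 := rfl
@[simp] theorem snd_left (r) : (left r).snd = r := rfl
@[simp] theorem fst_right (r) : (right r).fst = 1 := rfl
@[simp] theorem snd_right (r) : (right r).snd = r := rfl
@[simp] theorem fst_bottom (r) : (bottom r).fst = r := rfl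
@[simp] theorem snd_bottom (r) : (bottom r).snd = 0 := rfl
@[simp] theorem fst_top (r) : (top r).fst = r := rfl
@[simp] theorem snd_top (r) : (top r).snd = 1 := rfl

end SquareBoundary

namespace SquaMS

/-- The morphism `M ⊗ X ⟶ Z` given by one `1/3`-Lipschitz map on each copy of `X`. -/
def tensorLift {X Z : SquaMS.{u}} (c : Idx → X → Z)
    (hE : ∀ {m n p q}, E (m, p) (n, q) → c m (X.S p) = c n (X.S q))
    (hdist : ∀ m x y, dist (c m x) (c m y) ≤ dist x y / 3)
    (hS : ∀ p, c (cell p) (X.S (rel p)) = Z.S p) : X.tensor ⟶ Z :=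
  tensorDesc (fun a => c a.1 a.2)
    (by
      rintro ⟨m, _⟩ ⟨n, _⟩ ⟨p, q, h, rfl, rfl⟩
      exact hE h)
    (by
      rintro ⟨m, x⟩ ⟨n, y⟩
      unfold prodDist
      split_ifs with h
      · obtain rfl : m = n := h
        exact hdist m x y
      · exact Z.dist_le_two _ _)
    hS

theorem tensor_hom_ext {X Z : SquaMS.{u}} {f g : X.tensor ⟶ Z}
    (h : ∀ m x, Hom.toFun f (tmk (m, x)) = Hom.toFun g (tmk (m, x))) : f = g := by
  apply Hom.ext
  funext t
  obtain ⟨m, x⟩ := t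
  exact h m x

theorem tmk_eq_of_E {X : SquaMS.{u}} {m n : Idx} {p q : SquareBoundary} (h : E (m, p) (n, q)) :
    tmk (m, X.S p) = tmk (n, X.S q) :=
  tmk_eq (.rel _ _ ⟨p, q, h, rfl, rfl⟩)

/-! ### The initial algebra -/

/-- The unit square, the underlying space of an algebra. -/
@[ext]
structure UnitSquare : Type u where
  x : Set.Icc (0 : ℝ) 1
  y : Set.Icc (0 : ℝ) 1

namespace UnitSquare

/-- The taxicab metric on the unit square, induced by the `L¹` metric of the plane. -/
instance : MetricSpace UnitSquare.{u} :=
  .induced (fun a => WithLp.toLp 1 ((a.x : ℝ), (a.y : ℝ)))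
    (fun _ _ h => UnitSquare.ext (Subtype.ext (congrArg WithLp.fst h))
      (Subtype.ext (congrArg WithLp.snd h)))
    inferInstance

theorem dist_eq (a b : UnitSquare.{u}) : dist a b = |(a.x : ℝ) - b.x| + |(a.y : ℝ) - b.y| :=
  WithLp.prod_dist_eq_of_L1 (WithLp.toLp 1 ((a.x : ℝ), (a.y : ℝ))) (WithLp.toLp 1 (↑b.x, ↑b.y))

/-- The point with relative position `a` in the cell `m` of the subdivided unit square. -/
def inCell (m : Idx) (a : UnitSquare.{u}) : UnitSquare.{u} where
  x := ⟨(m.col + a.x) / 3, by constructor <;> linarith [m.bounds.1, m.bounds.2.1, a.x.2.1, a.x.2.2]⟩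
  y := ⟨(m.row + a.y) / 3, by
    constructor <;> linarith [m.bounds.2.2.1, m.bounds.2.2.2, a.y.2.1, a.y.2.2]⟩

theorem dist_inCell (m : Idx) (a b : UnitSquare.{u}) :
    dist (inCell m a) (inCell m b) = dist a b / 3 := by
  simp only [dist_eq, inCell, div_sub_div_same, add_sub_add_left_eq_sub, abs_div, Nat.abs_ofNat,
    add_div]

end UnitSquare

/-- The unit square with the taxicab metric as a square metric space. -/
def unitSquare : SquaMS.{u} where
  carrier := UnitSquare.{u}
  dist_le_two a b := by
    rw [UnitSquare.dist_eq]
    linarith [abs_sub_le_of_nonneg_of_le a.x.2.1 a.x.2.2 b.x.2.1 b.x.2.2,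
      abs_sub_le_of_nonneg_of_le a.y.2.1 a.y.2.2 b.y.2.1 b.y.2.2]
  S p := ⟨⟨p.fst, p.fst_mem⟩, ⟨p.snd, p.snd_mem⟩⟩
  S_injective p q h := SquareBoundary.ext' (congrArg (fun a : UnitSquare.{u} => (a.x : ℝ)) h)
    (congrArg (fun a : UnitSquare.{u} => (a.y : ℝ)) h)
  sq₁_left r s := by simp [UnitSquare.dist_eq, abs_sub_comm]
  sq₁_right r s := by simp [UnitSquare.dist_eq, abs_sub_comm]
  sq₁_bottom r s := by simp [UnitSquare.dist_eq, abs_sub_comm]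
  sq₁_top r s := by simp [UnitSquare.dist_eq, abs_sub_comm]
  sq₂ p q := (UnitSquare.dist_eq ⟨⟨p.fst, p.fst_mem⟩, ⟨p.snd, p.snd_mem⟩⟩
    ⟨⟨q.fst, q.fst_mem⟩, ⟨q.snd, q.snd_mem⟩⟩).ge

/-- The unit square as an algebra: `m ⊗ a ↦ (m + a) / 3`. -/
def unitSquareAlgebra : Endofunctor.Algebra tensorFunctor.{u} where
  a := unitSquare
  str := tensorLift (Z := unitSquare.{u}) UnitSquare.inCell
    (fun h => UnitSquare.ext (Subtype.ext (congrArg (· / 3) (E_pos h).1))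
      (Subtype.ext (congrArg (· / 3) (E_pos h).2)))
    (fun m a b => (UnitSquare.dist_inCell m a b).le)
    (fun p => UnitSquare.ext
      (Subtype.ext ((div_eq_iff (by norm_num)).2 ((cell_rel p).1.trans (mul_comm _ _))))
      (Subtype.ext ((div_eq_iff (by norm_num)).2 ((cell_rel p).2.trans (mul_comm _ _)))))

/-- The closed terms `m₁ ⊗ (m₂ ⊗ ⋯ ⊗ S p)`, which have a value in every algebra. -/
inductive Term : Type u
  | boundary (p : SquareBoundary)
  | cons (m : Idx) (t : Term)

namespace Term

/-- The value of a term in an algebra. -/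
def eval (A : Endofunctor.Algebra tensorFunctor.{u}) : Term.{u} → A.a
  | boundary p => A.a.S p
  | cons m t => Hom.toFun A.str (tmk (m, t.eval A))

theorem bddAbove_dist_eval (s t : Term.{u}) : BddAbove (Set.range
    fun A : Endofunctor.Algebra tensorFunctor.{u} => dist (s.eval A) (t.eval A)) :=
  ⟨2, by rintro _ ⟨A, rfl⟩; exact A.a.dist_le_two _ _⟩

instance : Nonempty (Endofunctor.Algebra tensorFunctor.{u}) := ⟨unitSquareAlgebra⟩

/-- The distance of two terms is the largest distance of their values in an algebra: the least
pseudometric for which the evaluation in every algebra is short. -/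
instance : PseudoMetricSpace Term.{u} where
  dist s t := ⨆ A : Endofunctor.Algebra tensorFunctor.{u}, dist (s.eval A) (t.eval A)
  dist_self s := by simp
  dist_comm s t := by simp only [dist_comm]
  dist_triangle s t v := ciSup_le fun A => (dist_triangle _ (t.eval A) _).trans
    (add_le_add (le_ciSup (bddAbove_dist_eval s t) A) (le_ciSup (bddAbove_dist_eval t v) A))

theorem dist_eval_le (A : Endofunctor.Algebra tensorFunctor.{u}) (s t : Term.{u}) :
    dist (s.eval A) (t.eval A) ≤ dist s t := le_ciSup (bddAbove_dist_eval s t) A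

theorem dist_le_of_forall {s t : Term.{u}} {c : ℝ}
    (h : ∀ A : Endofunctor.Algebra tensorFunctor.{u}, dist (s.eval A) (t.eval A) ≤ c) :
    dist s t ≤ c := ciSup_le h

theorem dist_eq_of_forall {s t : Term.{u}} {c : ℝ}
    (h : ∀ A : Endofunctor.Algebra tensorFunctor.{u}, dist (s.eval A) (t.eval A) = c) :
    dist s t = c :=
  (iSup_congr h).trans ciSup_const

theorem inseparable_of_forall {s t : Term.{u}}
    (h : ∀ A : Endofunctor.Algebra tensorFunctor.{u}, s.eval A = t.eval A) : Inseparable s t :=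
  Metric.inseparable_iff.2 (dist_eq_of_forall fun A => dist_eq_zero.2 (h A))

theorem dist_cons_le (m : Idx) (s t : Term.{u}) : dist (s.cons m) (t.cons m) ≤ dist s t / 3 :=
  dist_le_of_forall fun A => ((Hom.short A.str _ _).trans (dist_tmk_same m _ _)).trans
    (div_le_div_of_nonneg_right (dist_eval_le A s t) (by norm_num))

end Term

/-- The square metric space of terms, in which terms with the same value in all algebras are
identified. -/
def termSpace : SquaMS.{u} where
  carrier := SeparationQuotient Term.{u}
  dist_le_two := by
    rintro ⟨s⟩ ⟨t⟩
    exact Term.dist_le_of_forall fun A => A.a.dist_le_two _ _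
  S p := .mk (.boundary p)
  S_injective p q h := by
    refine unitSquareAlgebra.{u}.a.S_injective (dist_le_zero.1 ?_)
    rw [← dist_eq_zero.2 h]
    exact Term.dist_eval_le unitSquareAlgebra (.boundary p) (.boundary q)
  sq₁_left r s := Term.dist_eq_of_forall fun A => A.a.sq₁_left r s
  sq₁_right r s := Term.dist_eq_of_forall fun A => A.a.sq₁_right r s
  sq₁_bottom r s := Term.dist_eq_of_forall fun A => A.a.sq₁_bottom r s
  sq₁_top r s := Term.dist_eq_of_forall fun A => A.a.sq₁_top r s
  sq₂ p q := (unitSquareAlgebra.{u}.a.sq₂ p q).trans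
    (Term.dist_eval_le unitSquareAlgebra (.boundary p) (.boundary q))

/-- The operation `m ⊗ -` on the space of terms. -/
def termCons (m : Idx) : termSpace.{u} → termSpace.{u} :=
  SeparationQuotient.lift (fun t => SeparationQuotient.mk (Term.cons m t)) fun s t h =>
    SeparationQuotient.mk_eq_mk.2 <| Metric.inseparable_iff.2 <| le_antisymm
      ((Term.dist_cons_le m s t).trans (by simp [Metric.inseparable_iff.1 h])) dist_nonneg

/-- The algebra of terms. -/
def termAlgebra : Endofunctor.Algebra tensorFunctor.{u} where
  a := termSpace
  str := tensorLift (Z := termSpace.{u}) termCons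
    (fun h => SeparationQuotient.mk_eq_mk.2 <| Term.inseparable_of_forall fun A =>
      congrArg (Hom.toFun A.str) (tmk_eq_of_E h))
    (by
      rintro m ⟨s⟩ ⟨t⟩
      exact Term.dist_cons_le m s t)
    (fun p => SeparationQuotient.mk_eq_mk.2 <| Term.inseparable_of_forall fun A =>
      Hom.map_S A.str p)

/-- The evaluation of terms in an algebra. -/
def termHom (A : Endofunctor.Algebra tensorFunctor.{u}) : termAlgebra ⟶ A where
  f :=
    { toFun := SeparationQuotient.lift (Term.eval A) fun s t h => by
        rw [← dist_le_zero, ← Metric.inseparable_iff.1 h]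
        exact Term.dist_eval_le A s t
      short := by
        rintro ⟨s⟩ ⟨t⟩
        exact Term.dist_eval_le A s t
      map_S := fun _ => rfl }
  h := tensor_hom_ext fun m x => by
    obtain ⟨t⟩ := x
    rfl

theorem termHom_unique (A : Endofunctor.Algebra tensorFunctor.{u}) (f : termAlgebra ⟶ A) :
    f = termHom A := by
  apply Endofunctor.Algebra.Hom.ext
  apply Hom.ext
  funext x
  obtain ⟨t, rfl⟩ := SeparationQuotient.surjective_mk x
  induction t with
  | boundary p => exact Hom.map_S f.f p
  | cons m t ih =>
    have hf := congrFun (congrArg Hom.toFun f.h) (tmk (m, SeparationQuotient.mk t))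
    exact hf.symm.trans (congrArg (fun y => Hom.toFun A.str (tmk (m, y))) ih)

def termAlgebraIsInitial : Limits.IsInitial termAlgebra.{u} :=
  .ofUniqueHom termHom termHom_unique

end SquaMS

namespace SquareBoundary

/-- The reflection of the boundary of the unit square in the diagonal. -/
def swap (p : SquareBoundary) : SquareBoundary :=
  ⟨(p.snd, p.fst), p.snd_mem, p.fst_mem, p.2.2.2.symm⟩

end SquareBoundary

namespace SquaMS

/-! ### Reflection in the diagonal -/

/-- The reflection of the `3 × 3` grid in the diagonal. -/
def Idx.swap (m : Idx) : Idx :=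
  ⟨m.1.swap, fun h => m.2 (Prod.swap_injective h)⟩

theorem E.swap {m n : Idx} {p q : SquareBoundary} (h : E (m, p) (n, q)) :
    E (n.swap, q.swap) (m.swap, p.swap) := by
  cases h
  exacts [.e8 _, .e7 _, .e6 _, .e5 _, .e4 _, .e3 _, .e2 _, .e1 _]

/-- The square metric space with the roles of the two coordinates interchanged. It reduces
statements about top and bottom sides to statements about left and right sides. -/
def transpose (X : SquaMS.{u}) : SquaMS.{u} where
  carrier := X
  dist_le_two := X.dist_le_two
  S p := X.S p.swap
  S_injective _ _ h := congrArg SquareBoundary.swap (X.S_injective h)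
  sq₁_left := X.sq₁_bottom
  sq₁_right := X.sq₁_top
  sq₁_bottom := X.sq₁_left
  sq₁_top := X.sq₁_right
  sq₂ p q := (add_comm _ _).trans_le (X.sq₂ p.swap q.swap)

/-- A morphism, viewed as a morphism between the transposed spaces. -/
def transposeMap {X Y : SquaMS.{u}} (f : X ⟶ Y) : X.transpose ⟶ Y.transpose where
  toFun := Hom.toFun (X := X) (Y := Y) f
  short := Hom.short (X := X) (Y := Y) f
  map_S p := Hom.map_S (X := X) (Y := Y) f p.swap

/-- The reflection of the grid as a morphism from `M ⊗ X` to the transpose of `M ⊗ Xᵀ`. -/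
def tensorTranspose (X : SquaMS.{u}) : X.tensor ⟶ X.transpose.tensor.transpose :=
  tensorLift (Z := X.transpose.tensor.transpose) (fun m x => tmk (X := X.transpose) (m.swap, x))
    (fun h => (tmk_eq_of_E (X := X.transpose) h.swap).symm)
    (fun m => dist_tmk_same (X := X.transpose) m.swap)
    (fun _ => rfl)

/-- The transpose of a coalgebra structure. -/
def transposeCoalgebra {X : SquaMS.{u}} (β : X ⟶ X.tensor) : X.transpose ⟶ X.transpose.tensor :=
  transposeMap (β ≫ tensorTranspose X)

/-- The transpose of an algebra structure. -/
def transposeAlgebra {X : SquaMS.{u}} (α : X.tensor ⟶ X) : X.transpose.tensor ⟶ X.transpose :=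
  tensorTranspose X.transpose ≫ transposeMap α

variable {X : SquaMS.{u}}

/-! ### Distances of boundary points -/

theorem dist_S_of_fst_eq {p q : SquareBoundary} (hp : p.fst = 0 ∨ p.fst = 1)
    (hpq : p.fst = q.fst) : dist (X.S p) (X.S q) = |p.snd - q.snd| := by
  rw [abs_sub_comm]
  rcases hp with hp | hp
  · rw [SquareBoundary.eq_left hp, SquareBoundary.eq_left (hpq.symm.trans hp)]
    exact X.sq₁_left _ _
  · rw [SquareBoundary.eq_right hp, SquareBoundary.eq_right (hpq.symm.trans hp)]
    exact X.sq₁_right _ _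

theorem dist_S_of_snd_eq {p q : SquareBoundary} (hp : p.snd = 0 ∨ p.snd = 1)
    (hpq : p.snd = q.snd) : dist (X.S p) (X.S q) = |p.fst - q.fst| :=
  dist_S_of_fst_eq (X := X.transpose) (p := p.swap) (q := q.swap) hp hpq

theorem dist_S_le_taxi_of_adjacent {p q : SquareBoundary} (hp : p.fst = 0 ∨ p.fst = 1)
    (hq : q.snd = 0 ∨ q.snd = 1) :
    dist (X.S p) (X.S q) ≤ |p.fst - q.fst| + |p.snd - q.snd| := by
  let corner : SquareBoundary := ⟨(p.fst, q.snd), p.fst_mem, q.snd_mem, .inl hp⟩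
  calc dist (X.S p) (X.S q)
    _ ≤ dist (X.S p) (X.S corner) + dist (X.S corner) (X.S q) := dist_triangle _ _ _
    _ = |p.snd - q.snd| + |p.fst - q.fst| :=
      congrArg₂ (· + ·) (dist_S_of_fst_eq (q := corner) hp rfl)
        (dist_S_of_snd_eq (p := corner) hq rfl)
    _ = _ := add_comm _ _

theorem dist_S_le_taxi_or_opposite (p q : SquareBoundary) :
    (∀ X : SquaMS.{u}, dist (X.S p) (X.S q) ≤ |p.fst - q.fst| + |p.snd - q.snd|) ∨
      |p.fst - q.fst| = 1 ∨ |p.snd - q.snd| = 1 := by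
  rcases p.2.2.2 with hp | hp <;> rcases q.2.2.2 with hq | hq
  · by_cases h : p.fst = q.fst
    · exact .inl fun X => by rw [dist_S_of_fst_eq hp h]; simp
    · refine .inr (.inl ?_)
      rcases hp with hp | hp <;> rcases hq with hq | hq <;>
        change p.fst = _ at hp <;> change q.fst = _ at hq <;> simp_all
  · exact .inl fun X => dist_S_le_taxi_of_adjacent hp hq
  · refine .inl fun X => ?_
    rw [dist_comm, abs_sub_comm p.fst, abs_sub_comm p.snd]
    exact dist_S_le_taxi_of_adjacent hq hp
  · by_cases h : p.snd = q.snd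
    · exact .inl fun X => by rw [dist_S_of_snd_eq hp h]; simp
    · refine .inr (.inr ?_)
      rcases hp with hp | hp <;> rcases hq with hq | hq <;>
        change p.snd = _ at hp <;> change q.snd = _ at hq <;> simp_all

theorem dist_S_le_two_mul_taxi (p q : SquareBoundary) :
    dist (X.S p) (X.S q) ≤ 2 * (|p.fst - q.fst| + |p.snd - q.snd|) := by
  have hfst := abs_nonneg (p.fst - q.fst)
  have hsnd := abs_nonneg (p.snd - q.snd)
  rcases dist_S_le_taxi_or_opposite p q with h | h | h
  · linarith [h X]
  · linarith [X.dist_le_two (X.S p) (X.S q)]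
  · linarith [X.dist_le_two (X.S p) (X.S q)]

theorem dist_le_two_mul_pathDist (m : Idx) (p q : SquareBoundary) :
    dist (X.S p) (X.S q) / 3 ≤ 2 * pathDist X (m, X.S p) (m, X.S q) := by
  have htaxi := taxi_le_pathDist (X := X) m m p q
  simp only [div_sub_div_same, add_sub_add_left_eq_sub, abs_div, Nat.abs_ofNat] at htaxi
  linarith [dist_S_le_two_mul_taxi (X := X) p q]

/-! ### Paths leave a copy through its boundary -/

theorem eq_or_mem_range_S_of_glueSetoid {a b : Idx × X} (h : glueSetoid X a b) :
    a = b ∨ a.2 ∈ Set.range X.S ∧ b.2 ∈ Set.range X.S := by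
  induction h with
  | rel a b h =>
    obtain ⟨p, q, -, hp, hq⟩ := h
    exact .inr ⟨⟨p, hp.symm⟩, ⟨q, hq.symm⟩⟩
  | refl => exact .inl rfl
  | symm a b _ ih => exact ih.imp Eq.symm And.symm
  | trans a b c _ _ hab hbc => grind

theorem stepScore_of_notMem_range {a b : Idx × X} (ha : a.2 ∉ Set.range X.S) :
    stepScore X a b = prodDist X a b := by
  unfold stepScore
  split_ifs with h
  · obtain rfl | ⟨hS, -⟩ := eq_or_mem_range_S_of_glueSetoid h
    · simp [prodDist]
    · exact absurd hS ha
  · rfl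

/-- Identifications concern only boundary points, so a cheap path either stays in the copy of `a` or
leaves it through the boundary. -/
theorem le_pathDist_of_forall_boundary {c : ℝ} {a b : Idx × X} (hc : c ≤ 2)
    (hdirect : a.1 = b.1 → c ≤ dist a.2 b.2 / 3)
    (hvia : ∀ p, c ≤ dist a.2 (X.S p) / 3 + pathDist X (a.1, X.S p) b) :
    c ≤ pathDist X a b := by
  refine le_ciInf fun l => ?_
  induction l generalizing a c with
  | nil =>
    by_cases ha : a.2 ∈ Set.range X.S
    · obtain ⟨p, hp⟩ := ha
      simpa [hp] using (hvia p).trans (add_le_add_right (pathDist_le_score _ [] _) _)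
    · rw [score, stepScore_of_notMem_range ha, prodDist]
      split_ifs with h
      exacts [hdirect h, hc]
  | cons d l ih =>
    by_cases ha : a.2 ∈ Set.range X.S
    · obtain ⟨p, hp⟩ := ha
      simpa [hp] using (hvia p).trans (add_le_add_right (pathDist_le_score _ (d :: l) _) _)
    rw [score, stepScore_of_notMem_range ha, prodDist]
    split_ifs with h
    · have key : c - dist a.2 d.2 / 3 ≤ score X d l b := by
        refine ih ?_ (fun hb => ?_) (fun p => ?_)
        · linarith [dist_nonneg (x := a.2) (y := d.2)]
        · linarith [hdirect (h.trans hb), dist_triangle a.2 d.2 b.2]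
        · have := hvia p
          rw [h] at this
          linarith [dist_triangle a.2 d.2 (X.S p)]
      linarith
    · linarith [score_nonneg d l b]

theorem le_pathDist_of_forall_boundary₂ {c : ℝ} {m n : Idx} {x y : X} (hc : c ≤ 2)
    (hdirect : m = n → c ≤ dist x y / 3)
    (hvia : ∀ p q, c ≤ dist x (X.S p) / 3 + pathDist X (m, X.S p) (n, X.S q) +
      dist (X.S q) y / 3) :
    c ≤ pathDist X (m, x) (n, y) := by
  refine le_pathDist_of_forall_boundary hc hdirect fun p => ?_
  rw [pathDist_comm, ← sub_le_iff_le_add']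
  refine le_pathDist_of_forall_boundary ?_ (fun h => ?_) fun q => ?_
  · linarith [dist_nonneg (x := x) (y := X.S p)]
  · obtain rfl : n = m := h
    linarith [hdirect rfl, dist_triangle_right x y (X.S p)]
  · rw [pathDist_comm, sub_le_iff_le_add, dist_comm y]
    linarith [hvia p q]

theorem dist_le_six_mul_pathDist (m : Idx) (x y : X) :
    dist x y ≤ 6 * pathDist X (m, x) (m, y) := by
  suffices dist x y / 6 ≤ pathDist X (m, x) (m, y) by linarith
  refine le_pathDist_of_forall_boundary₂ ?_ (fun _ => ?_) fun p q => ?_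
  · linarith [X.dist_le_two x y]
  · linarith [dist_nonneg (x := x) (y := y)]
  · linarith [dist_triangle4 x (X.S p) (X.S q) y, dist_le_two_mul_pathDist (X := X) m p q,
      dist_nonneg (x := x) (y := X.S p), dist_nonneg (x := X.S q) (y := y)]

end SquaMS

theorem isComplete_iUnion_of_finite {α ι : Type*} [UniformSpace α] [Finite ι] {s : ι → Set α}
    (hs : ∀ i, IsComplete (s i)) : IsComplete (⋃ i, s i) := by
  refine isComplete_iff_ultrafilter'.2 fun l hl hmem => ?_
  rw [← Set.biUnion_univ, Ultrafilter.finite_biUnion_mem_iff Set.finite_univ] at hmem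
  obtain ⟨i, -, hi⟩ := hmem
  obtain ⟨x, hx, hlx⟩ := isComplete_iff_ultrafilter'.1 (hs i) l hl hi
  exact ⟨x, Set.mem_iUnion.2 ⟨i, hx⟩, hlx⟩

namespace SquaMS

variable {X : SquaMS.{u}}

/-! ### Completeness and the canonical morphism -/

theorem coe_one_third_mul (t : ℝ) : ((1 / 3 : NNReal) : ℝ) * t = t / 3 := by
  rw [NNReal.coe_div, NNReal.coe_one, NNReal.coe_ofNat, one_div_mul_eq_div]

theorem lipschitzWith_tmk (m : Idx) : LipschitzWith (1 / 3) fun x : X => tmk (m, x) :=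
  .of_dist_le_mul fun x y => (dist_tmk_same m x y).trans_eq (coe_one_third_mul _).symm

theorem antilipschitzWith_tmk (m : Idx) : AntilipschitzWith 6 fun x : X => tmk (m, x) :=
  .of_le_mul_dist fun x y => dist_le_six_mul_pathDist m x y

instance [CompleteSpace X] : CompleteSpace X.Tensor := by
  have range_tmk : ⋃ m, Set.range (fun x : X => tmk (m, x)) = Set.univ := by
    refine Set.eq_univ_of_forall ?_
    rintro ⟨m, x⟩
    exact Set.mem_iUnion.2 ⟨m, x, rfl⟩
  refine completeSpace_of_isComplete_univ (range_tmk ▸ isComplete_iUnion_of_finite fun m => ?_)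
  exact (antilipschitzWith_tmk m).isComplete_range (lipschitzWith_tmk m).uniformContinuous

theorem isIso_of_isometry_of_surjective {Y : SquaMS.{u}} (f : X ⟶ Y)
    (hf : Isometry (Hom.toFun f)) (hsurj : Function.Surjective (Hom.toFun f)) : IsIso f := by
  let e : X ≃ Y := .ofBijective (Hom.toFun f) ⟨hf.injective, hsurj⟩
  have he (y : Y) : Hom.toFun f (e.symm y) = y := e.apply_symm_apply y
  refine ⟨⟨e.symm, fun x y => ?_, fun p => ?_⟩, Hom.ext ?_, Hom.ext (funext he)⟩
  · rw [← hf.dist_eq, he, he]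
  · rw [e.symm_apply_eq]
    exact (Hom.map_S f p).symm
  · exact funext e.symm_apply_apply

theorem comparison_coe (m : Idx) (x : X) :
    Hom.toFun (comparison X) (tmk (X := X.completion) (m, (x : Completion X))) =
      ((tmk (m, x) : X.Tensor) : Completion X.Tensor) :=
  Completion.map_coe (lipschitzWith_tmk m).uniformContinuous x

/-- The embedding of `X` into its completion, as a morphism. -/
def toCompletion (X : SquaMS.{u}) : X ⟶ X.completion where
  toFun x := (x : Completion X)
  short x y := (Completion.dist_eq x y).le
  map_S _ := rfl

/-- `δ` is short, and on points of `X` it is inverted by the short map `M ⊗ toCompletion X`. -/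
theorem isometry_comparison (X : SquaMS.{u}) : Isometry (Hom.toFun (comparison X)) := by
  refine .of_dist_eq ?_
  rintro ⟨m, (x : Completion X)⟩ ⟨n, (y : Completion X)⟩
  have hδ : Continuous (Hom.toFun (comparison X)) := (Hom.lipschitz (comparison X)).continuous
  have htmk (k : Idx) : Continuous fun z : Completion X => tmk (X := X.completion) (k, z) :=
    (lipschitzWith_tmk (X := X.completion) k).continuous
  have hm := (htmk m).comp (continuous_fst (Y := Completion X))
  have hn := (htmk n).comp (continuous_snd (X := Completion X))
  induction x, y using Completion.induction_on₂ with
  | hp => exact isClosed_eq ((hδ.comp hm).dist (hδ.comp hn)) (hm.dist hn)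
  | ih x y =>
    refine le_antisymm (Hom.short (comparison X) _ _) ?_
    refine (Hom.short (tensorFunctor.map (toCompletion X)) (tmk (m, x)) (tmk (n, y))).trans ?_
    exact (Completion.dist_eq _ _).ge.trans_eq
      (congrArg₂ dist (comparison_coe m x).symm (comparison_coe n y).symm)

theorem isIso_comparison (X : SquaMS.{u}) : IsIso (comparison X) := by
  refine isIso_of_isometry_of_surjective _ (isometry_comparison X) fun z => ?_
  have : CompleteSpace X.completion := inferInstanceAs (CompleteSpace (Completion X))
  have : CompleteSpace (tensorFunctor.obj (completionFunctor.obj X)) :=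
    inferInstanceAs (CompleteSpace X.completion.Tensor)
  have isClosed_range : IsClosed (Set.range (Hom.toFun (comparison X))) :=
    (isometry_comparison X).isUniformInducing.isComplete_range.isClosed
  induction z using Completion.induction_on with
  | hp => exact isClosed_range
  | ih t =>
    obtain ⟨m, x⟩ := t
    exact ⟨_, comparison_coe m x⟩

end SquaMS

theorem exists_lipschitzWith_extension_mem_Icc {α : Type*} [PseudoMetricSpace α] {f : α → ℝ}
    {s : Set α} {K : NNReal} {a b : ℝ} (hab : a ≤ b) (hf : LipschitzOnWith K f s)
    (hmem : ∀ x ∈ s, f x ∈ Set.Icc a b) :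
    ∃ g : α → ℝ, LipschitzWith K g ∧ (∀ x, g x ∈ Set.Icc a b) ∧ Set.EqOn f g s := by
  obtain ⟨g, hg, hfg⟩ := hf.extend_real
  refine ⟨fun x => Set.projIcc a b hab (g x), ?_, fun x => (Set.projIcc a b hab (g x)).2,
    fun x hx => ?_⟩
  · have := (LipschitzWith.subtype_val _).comp ((LipschitzWith.projIcc hab).comp hg)
    rwa [one_mul, one_mul] at this
  · simp only [← hfg hx, Set.projIcc_of_mem hab (hmem x hx)]

namespace SquaMS

variable {X : SquaMS.{u}}

/-! ### Opposite sides -/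

/-- By McShane's theorem `φ` extends from the boundaries of the cells to the cells. -/
theorem abs_sub_le_pathDist {φ : Idx → SquareBoundary → ℝ} (hmem : ∀ m p, φ m p ∈ Set.Icc 0 2)
    (hφ : ∀ m p q, |φ m p - φ m q| ≤ dist (X.S p) (X.S q) / 3)
    (hE : ∀ m n p q, E (m, p) (n, q) → φ m p = φ n q) (m n : Idx) (p q : SquareBoundary) :
    |φ m p - φ n q| ≤ pathDist X (m, X.S p) (n, X.S q) := by
  have extension (m : Idx) : ∃ g : X → ℝ, (∀ x y, |g x - g y| ≤ dist x y / 3) ∧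
      (∀ x, g x ∈ Set.Icc 0 2) ∧ ∀ p, g (X.S p) = φ m p := by
    have extend_S (p) : Function.extend X.S (φ m) 0 (X.S p) = φ m p :=
      X.S_injective.extend_apply ..
    obtain ⟨g, hg, hgmem, hgS⟩ := exists_lipschitzWith_extension_mem_Icc zero_le_two
      (f := Function.extend X.S (φ m) 0) (s := Set.range X.S) (K := 1 / 3)
      (.of_dist_le_mul <| by
        rintro _ ⟨p, rfl⟩ _ ⟨q, rfl⟩
        rw [extend_S, extend_S, coe_one_third_mul]
        exact hφ m p q)
      (by rintro _ ⟨p, rfl⟩; exact extend_S p ▸ hmem m p)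
    exact ⟨g, fun x y => (hg.dist_le_mul x y).trans_eq (coe_one_third_mul _), hgmem,
      fun p => (hgS ⟨p, rfl⟩).symm.trans (extend_S p)⟩
  choose g hg hgmem hgS using extension
  rw [← hgS, ← hgS]
  refine short_of_prodDist (fun a => g a.1 a.2) ?_ ?_ (m, X.S p) (n, X.S q)
  · rintro ⟨m, _⟩ ⟨n, _⟩ ⟨p, q, h, rfl, rfl⟩
    exact (hgS m p).trans ((hE m n p q h).trans (hgS n q).symm)
  · rintro ⟨m, x⟩ ⟨n, y⟩
    rw [prodDist]
    split_ifs with h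
    · obtain rfl : m = n := h
      exact hg m x y
    · exact (Real.dist_le_of_mem_Icc (hgmem m x) (hgmem n y)).trans_eq (sub_zero 2)

end SquaMS

namespace SquaMS

/-- The end points of the intervals that are removed from the unit interval to obtain the Cantor
set. At these heights the Sierpiński carpet contains an entire horizontal line. -/
inductive IsCantorEnd : ℝ → Prop
  | zero : IsCantorEnd 0
  | one : IsCantorEnd 1
  | low {c : ℝ} : IsCantorEnd c → IsCantorEnd (c / 3)
  | high {c : ℝ} : IsCantorEnd c → IsCantorEnd ((2 + c) / 3)

theorem IsCantorEnd.mem_Icc {c : ℝ} (hc : IsCantorEnd c) : c ∈ Set.Icc (0 : ℝ) 1 := by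
  induction hc with
  | zero => exact Set.left_mem_Icc.2 zero_le_one
  | one => exact Set.right_mem_Icc.2 zero_le_one
  | low _ ih => constructor <;> linarith [ih.1, ih.2]
  | high _ ih => constructor <;> linarith [ih.1, ih.2]

theorem IsCantorEnd.add_div_three {c : ℝ} (hc : IsCantorEnd c) {j : Fin 3} (hj : j ≠ 1) :
    IsCantorEnd (((j : ℕ) + c) / 3) := by
  obtain rfl | rfl : j = 0 ∨ j = 2 := by omega
  · simpa using hc.low
  · simpa using hc.high

theorem isCantorEnd_add_div_three (j : Fin 3) {b : ℝ} (hb : b = 0 ∨ b = 1) :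
    IsCantorEnd (((j : ℕ) + b) / 3) := by
  by_cases hj : j = 1
  · subst hj
    rcases hb with rfl | rfl
    · simpa using IsCantorEnd.one.low
    · simpa [one_add_one_eq_two] using IsCantorEnd.zero.high
  · rcases hb with rfl | rfl
    exacts [.add_div_three .zero hj, .add_div_three .one hj]

/-- The length of the shortest way on the real line from `r` to `s` via a Cantor end point: the
vertical part of the length of a shortest path through the carpet from the height `r` on the left
side to the height `s` on the right side. -/
def detour (r s : ℝ) : ℝ := ⨅ c : {c : ℝ // IsCantorEnd c}, (|r - c| + |s - c|)

section Detour

variable {ε r s y : ℝ}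

instance : Nonempty {c : ℝ // IsCantorEnd c} := ⟨⟨0, .zero⟩⟩

theorem detour_le {c : ℝ} (hc : IsCantorEnd c) : detour r s ≤ |r - c| + |s - c| :=
  ciInf_le (f := fun c : {c : ℝ // IsCantorEnd c} => |r - c| + |s - c|)
    ⟨0, by rintro _ ⟨c, rfl⟩; positivity⟩ ⟨c, hc⟩

theorem detour_comm (r s : ℝ) : detour r s = detour s r := by
  simp only [detour, add_comm]

theorem detour_le_add_detour (r s s' : ℝ) : detour r s ≤ |r - s'| + detour s' s := by
  rw [← sub_le_iff_le_add']
  refine le_ciInf fun c => ?_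
  linarith [detour_le (r := r) (s := s) c.2, abs_sub_le r s' c]

theorem detour_le_one (hr : r ∈ Set.Icc (0 : ℝ) 1) (hs : s ∈ Set.Icc (0 : ℝ) 1) :
    detour r s ≤ 1 := by
  have via_zero := detour_le (r := r) (s := s) .zero
  have via_one := detour_le (r := r) (s := s) .one
  rw [sub_zero, sub_zero, abs_of_nonneg hr.1, abs_of_nonneg hs.1] at via_zero
  rw [abs_of_nonpos (sub_nonpos.2 hr.2), abs_of_nonpos (sub_nonpos.2 hs.2)] at via_one
  linarith

theorem abs_add_div_three_sub (k a b : ℝ) : |(k + a) / 3 - (k + b) / 3| = |a - b| / 3 := by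
  simp only [div_sub_div_same, add_sub_add_left_eq_sub, abs_div, Nat.abs_ofNat]

theorem detour_add_div_three_le {j : Fin 3} (hj : j ≠ 1) (b b' : ℝ) :
    detour (((j : ℕ) + b) / 3) (((j : ℕ) + b') / 3) ≤ detour b b' / 3 := by
  rw [le_div_iff₀ zero_lt_three]
  refine le_ciInf fun c => ?_
  have := detour_le (r := ((j : ℕ) + b) / 3) (s := ((j : ℕ) + b') / 3) (c.2.add_div_three hj)
  rw [abs_add_div_three_sub, abs_add_div_three_sub] at this
  linarith

/-- A lower bound for the vertical part of the length of a path from the height `r` on the left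
side to the height `y`, with an error `ε` that is admitted only where a detour is necessary. -/
def height (ε r y : ℝ) : ℝ := max (detour r y - ε) |y - r|

theorem abs_height_sub_le (ε r y y' : ℝ) : |height ε r y - height ε r y'| ≤ |y - y'| := by
  refine (abs_max_sub_max_le_max _ _ _ _).trans (max_le ?_ ?_)
  · have h := detour_le_add_detour y r y'
    have h' := detour_le_add_detour y' r y
    rw [detour_comm _ r, detour_comm _ r] at h h'
    rw [sub_sub_sub_cancel_right, abs_le]
    constructor <;> linarith [abs_sub_comm y y']
  · exact (abs_abs_sub_abs_le_abs_sub _ _).trans_eq (by rw [sub_sub_sub_cancel_right])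

theorem height_of_isCantorEnd (hε : 0 ≤ ε) (hy : IsCantorEnd y) : height ε r y = |y - r| := by
  refine max_eq_right ?_
  have := detour_le (r := r) (s := y) hy
  rw [sub_self, abs_zero, add_zero, abs_sub_comm] at this
  linarith

theorem height_mem_Icc (hε : 0 ≤ ε) (hr : r ∈ Set.Icc (0 : ℝ) 1) (hy : y ∈ Set.Icc (0 : ℝ) 1) :
    height ε r y ∈ Set.Icc 0 1 :=
  ⟨(abs_nonneg _).trans (le_max_right _ _), max_le (by linarith [detour_le_one hr hy])
    ((Real.dist_le_of_mem_Icc hy hr).trans_eq (sub_zero 1))⟩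

end Detour

/-- The first coordinate in the unit square of the point `p` of the boundary of the cell `m`. -/
def abscissa (m : Idx) (p : SquareBoundary) : ℝ := (m.col + p.fst) / 3

/-- The second coordinate in the unit square of the point `p` of the boundary of the cell `m`. -/
def ordinate (m : Idx) (p : SquareBoundary) : ℝ := (m.row + p.snd) / 3

theorem abscissa_mem_Icc (m : Idx) (p : SquareBoundary) : abscissa m p ∈ Set.Icc (0 : ℝ) 1 := by
  obtain ⟨h0, h2, -⟩ := m.bounds
  constructor <;> unfold abscissa <;> linarith [p.fst_nonneg, p.fst_le]

theorem ordinate_mem_Icc (m : Idx) (p : SquareBoundary) : ordinate m p ∈ Set.Icc (0 : ℝ) 1 := by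
  obtain ⟨-, -, h0, h2⟩ := m.bounds
  constructor <;> unfold ordinate <;> linarith [p.snd_nonneg, p.snd_le]

/-- A lower bound for the distance from the point of height `r` on the left side to the point `p`
of the cell `m`. Every path has to cross one of the two corner cells of the left column, since the
middle cell of that column has no neighbour on its right, so it is enough to count the detour from
the right sides of these corner cells on. -/
def crossFun (ε r : ℝ) (m : Idx) (p : SquareBoundary) : ℝ :=
  abscissa m p + if m.1.1 = 0 ∧ (m.1.2 = 1 ∨ p.fst < 1) then |ordinate m p - r|
    else height ε r (ordinate m p)

section CrossFun

variable {X : SquaMS.{u}} {ε r : ℝ} {m n : Idx} {p q : SquareBoundary}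

theorem crossFun_mem_Icc (hε : 0 ≤ ε) (hr : r ∈ Set.Icc (0 : ℝ) 1) (m : Idx)
    (p : SquareBoundary) : crossFun ε r m p ∈ Set.Icc 0 2 := by
  have hx := abscissa_mem_Icc m p
  have hy := ordinate_mem_Icc m p
  have hheight := height_mem_Icc hε hr hy
  have habs : |ordinate m p - r| ≤ 1 := (Real.dist_le_of_mem_Icc hy hr).trans_eq (sub_zero 1)
  unfold crossFun
  split_ifs <;> constructor <;>
    linarith [hx.1, hx.2, hheight.1, hheight.2, abs_nonneg (ordinate m p - r)]

theorem crossFun_of_snd (hε : 0 ≤ ε) (hp : p.snd = 0 ∨ p.snd = 1) :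
    crossFun ε r m p = abscissa m p + height ε r (ordinate m p) := by
  have : height ε r (ordinate m p) = |ordinate m p - r| :=
    height_of_isCantorEnd hε (isCantorEnd_add_div_three m.1.2 hp)
  rw [crossFun, this, ite_self]

theorem crossFun_eq_of_E (hε : 0 ≤ ε) (h : E (m, p) (n, q)) :
    crossFun ε r m p = crossFun ε r n q := by
  obtain ⟨hcol, hrow⟩ := E_pos h
  have hx : abscissa m p = abscissa n q := congrArg (· / 3) hcol
  have hy : ordinate m p = ordinate n q := congrArg (· / 3) hrow
  suffices ∀ {m p}, (p.snd = 0 ∨ p.snd = 1) ∨ ¬(m.1.1 = 0 ∧ (m.1.2 = 1 ∨ p.fst < 1)) →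
      crossFun ε r m p = abscissa m p + height ε r (ordinate m p) by
    rw [this, this, hx, hy] <;> cases h <;> simp
  rintro m p (h | h)
  exacts [crossFun_of_snd hε h, by rw [crossFun, if_neg h]]

theorem abs_abscissa_add_sub_le {f : ℝ → ℝ} (hf : ∀ y y', |f y - f y'| ≤ |y - y'|) :
    |(abscissa m p + f (ordinate m p)) - (abscissa m q + f (ordinate m q))| ≤
      dist (X.S p) (X.S q) / 3 := by
  have hx : |abscissa m p - abscissa m q| = |p.fst - q.fst| / 3 := abs_add_div_three_sub ..
  have hy : |ordinate m p - ordinate m q| = |p.snd - q.snd| / 3 := abs_add_div_three_sub ..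
  rw [add_sub_add_comm]
  linarith [abs_add_le (abscissa m p - abscissa m q) (f (ordinate m p) - f (ordinate m q)),
    hf (ordinate m p) (ordinate m q), X.sq₂ p q]

/-- Distances between the left and the right side are at least those in the carpet, up to `ε`. -/
def DetourBound (X : SquaMS.{u}) (ε : ℝ) : Prop :=
  ∀ r s : Set.Icc (0 : ℝ) 1, 1 + detour r s ≤ dist (X.S (.left r)) (X.S (.right s)) + ε

theorem abs_height_sub_abs_le_of_detourBound (hX : DetourBound X ε) (hm : m.1.2 ≠ 1)
    (hp : p.fst = 0) (hq : q.fst = 1) :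
    |(|ordinate m p - r|) - (1 / 3 + height (ε / 3) r (ordinate m q))| ≤
      dist (X.S p) (X.S q) / 3 := by
  have hbound := hX ⟨p.snd, p.snd_mem⟩ ⟨q.snd, q.snd_mem⟩
  rw [← SquareBoundary.eq_left hp, ← SquareBoundary.eq_right hq] at hbound
  have htaxi := X.sq₂ p q
  rw [hp, hq, zero_sub, abs_neg, abs_one] at htaxi
  have hy : |ordinate m p - ordinate m q| = |p.snd - q.snd| / 3 := abs_add_div_three_sub ..
  have hdetour : detour (ordinate m p) (ordinate m q) ≤ detour p.snd q.snd / 3 :=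
    detour_add_div_three_le hm _ _
  have upper : height (ε / 3) r (ordinate m q) ≤
      |ordinate m p - r| + dist (X.S p) (X.S q) / 3 - 1 / 3 := by
    refine max_le ?_ ?_
    · linarith [detour_le_add_detour r (ordinate m q) (ordinate m p),
        abs_sub_comm r (ordinate m p)]
    · linarith [abs_sub_le (ordinate m q) (ordinate m p) r,
        abs_sub_comm (ordinate m q) (ordinate m p)]
  have lower : |ordinate m q - r| ≤ height (ε / 3) r (ordinate m q) := le_max_right _ _
  rw [abs_le]
  constructor <;> linarith [abs_sub_le (ordinate m p) (ordinate m q) r]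

theorem abs_crossFun_sub_le_of_mixed (hε : 0 ≤ ε) (hX : DetourBound X ε)
    (hp : m.1.1 = 0 ∧ (m.1.2 = 1 ∨ p.fst < 1)) (hq : ¬(m.1.1 = 0 ∧ (m.1.2 = 1 ∨ q.fst < 1))) :
    |crossFun (ε / 3) r m p - crossFun (ε / 3) r m q| ≤ dist (X.S p) (X.S q) / 3 := by
  obtain ⟨hcol, hp'⟩ := hp
  have hrow : m.1.2 ≠ 1 := fun h => hq ⟨hcol, .inl h⟩
  have hq1 : q.fst = 1 := q.fst_le.antisymm (not_lt.1 fun h => hq ⟨hcol, .inr h⟩)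
  by_cases hsnd : p.snd = 0 ∨ p.snd = 1
  · rw [crossFun_of_snd (by positivity) hsnd, crossFun, if_neg hq]
    exact abs_abscissa_add_sub_le (abs_height_sub_le _ _)
  · have hp0 : p.fst = 0 :=
      (p.2.2.2.resolve_right hsnd).resolve_right (hp'.resolve_left hrow).ne
    have hm0 : m.col = 0 := by simp [Idx.col, hcol]
    rw [crossFun, crossFun, if_neg hq, if_pos ⟨hcol, hp'⟩, abscissa, abscissa, hp0, hq1, hm0,
      zero_add, zero_div, zero_add, zero_add]
    exact abs_height_sub_abs_le_of_detourBound hX hrow hp0 hq1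

theorem abs_crossFun_sub_le (hε : 0 ≤ ε) (hX : DetourBound X ε) (m : Idx)
    (p q : SquareBoundary) :
    |crossFun (ε / 3) r m p - crossFun (ε / 3) r m q| ≤ dist (X.S p) (X.S q) / 3 := by
  by_cases hp : m.1.1 = 0 ∧ (m.1.2 = 1 ∨ p.fst < 1) <;>
    by_cases hq : m.1.1 = 0 ∧ (m.1.2 = 1 ∨ q.fst < 1)
  · rw [crossFun, crossFun, if_pos hp, if_pos hq]
    refine abs_abscissa_add_sub_le (f := fun y => |y - r|) fun y y' => ?_
    exact (abs_abs_sub_abs_le_abs_sub _ _).trans_eq (by rw [sub_sub_sub_cancel_right])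
  · exact abs_crossFun_sub_le_of_mixed hε hX hp hq
  · rw [abs_sub_comm, dist_comm]
    exact abs_crossFun_sub_le_of_mixed hε hX hq hp
  · rw [crossFun, crossFun, if_neg hp, if_neg hq]
    exact abs_abscissa_add_sub_le (abs_height_sub_le _ _)

theorem crossFun_left (r : Set.Icc (0 : ℝ) 1) :
    crossFun ε r (cell (.left r)) (rel (.left r)) = 0 := by
  obtain ⟨hx, hy⟩ := cell_rel (.left r)
  rw [SquareBoundary.fst_left, mul_zero] at hx
  have hcol : (cell (.left r)).col = 0 := by
    linarith [(cell (.left r)).bounds.1, (rel (.left r)).fst_nonneg]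
  have hfst : (rel (.left r)).fst < 1 := by linarith
  rw [crossFun, if_pos ⟨Fin.ext (Nat.cast_eq_zero.1 hcol), .inr hfst⟩, abscissa, ordinate, hx, hy,
    SquareBoundary.snd_left, mul_div_cancel_left₀ _ three_ne_zero, sub_self, abs_zero, zero_div,
    add_zero]

theorem crossFun_right (s : Set.Icc (0 : ℝ) 1) :
    crossFun ε r (cell (.right s)) (rel (.right s)) = 1 + height ε r s := by
  obtain ⟨hx, hy⟩ := cell_rel (.right s)
  rw [SquareBoundary.fst_right] at hx
  have hcol : (cell (.right s)).1.1 ≠ 0 := by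
    intro h
    have : (cell (.right s)).col = 0 := by simp [Idx.col, h]
    linarith [(rel (.right s)).fst_le]
  rw [crossFun, if_neg fun h => hcol h.1, abscissa, ordinate, hx, hy, SquareBoundary.snd_right,
    mul_div_cancel_left₀ _ three_ne_zero, mul_div_cancel_left₀ _ three_ne_zero]

theorem DetourBound.tensor (hε : 0 ≤ ε) (hX : DetourBound X ε) :
    DetourBound X.tensor (ε / 3) := by
  intro r s
  have hε' : 0 ≤ ε / 3 := by positivity
  have key := abs_sub_le_pathDist (crossFun_mem_Icc hε' r.2) (abs_crossFun_sub_le hε hX)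
    (fun _ _ _ _ => crossFun_eq_of_E hε') (cell (.right s)) (cell (.left r)) (rel (.right s))
    (rel (.left r))
  rw [crossFun_left, crossFun_right, sub_zero, pathDist_comm] at key
  have hheight : detour r s - ε / 3 ≤ height (ε / 3) r s := le_max_left _ _
  rw [← sub_le_iff_le_add]
  exact (le_abs_self _).trans key |>.trans' (by linarith)

end CrossFun

end SquaMS

namespace SquaMS

variable {X Y : SquaMS.{u}}

theorem dist_S_le_of_hom (f : X ⟶ Y) (p q : SquareBoundary) :
    dist (Y.S p) (Y.S q) ≤ dist (X.S p) (X.S q) := by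
  rw [← Hom.map_S f, ← Hom.map_S f]
  exact Hom.short f _ _

theorem detourBound_one (X : SquaMS.{u}) : DetourBound X 1 := by
  intro r s
  have htaxi := X.sq₂ (.left r) (.right s)
  rw [SquareBoundary.fst_left, SquareBoundary.fst_right, zero_sub, abs_neg, abs_one] at htaxi
  linarith [detour_le_one r.2 s.2, abs_nonneg ((SquareBoundary.left r).snd -
    (SquareBoundary.right s).snd)]

theorem detourBound_pow_of_coalgebra (β : X ⟶ X.tensor) (n : ℕ) :
    DetourBound X ((1 / 3) ^ n) := by
  induction n with
  | zero => exact pow_zero (1 / 3 : ℝ) ▸ detourBound_one X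
  | succ n ih =>
    intro r s
    have := ih.tensor (by positivity) r s
    rw [pow_succ, mul_one_div]
    linarith [dist_S_le_of_hom β (.left r) (.right s)]

theorem one_add_detour_le_dist_of_coalgebra (β : X ⟶ X.tensor) (r s : Set.Icc (0 : ℝ) 1) :
    1 + detour r s ≤ dist (X.S (.left r)) (X.S (.right s)) := by
  refine le_of_forall_pos_le_add fun ε hε => ?_
  obtain ⟨n, hn⟩ := exists_pow_lt_of_lt_one hε (by norm_num : (1 / 3 : ℝ) < 1)
  exact (detourBound_pow_of_coalgebra β n r s).trans (by gcongr)

/-- Three copies of a path, one in each cell of an outer row, form a path again. -/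
theorem dist_left_right_le_of_algebra (α : X.tensor ⟶ X) {j : Fin 3} (hj : j ≠ 1)
    {c c' : Set.Icc (0 : ℝ) 1} (hc : (j : ℕ) + (c : ℝ) = 3 * c') :
    dist (X.S (.left c')) (X.S (.right c')) ≤ dist (X.S (.left c)) (X.S (.right c)) := by
  refine (dist_S_le_of_hom α _ _).trans ?_
  let m (i : Fin 3) : Idx := ⟨(i, j), fun h => hj (congrArg Prod.snd h)⟩
  have start_eq : X.tensor.S (.left c') = tmk (m 0, X.S (.left c)) :=
    tensorS_eq (by simp [m, Idx.col]) hc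
  have end_eq : X.tensor.S (.right c') = tmk (m 2, X.S (.right c)) :=
    tensorS_eq (by norm_num [m, Idx.col]) hc
  have glue₁ : tmk (m 0, X.S (.right c)) = tmk (m 1, X.S (.left c)) :=
    tmk_eq (glue_of_pos (by simp [m, Idx.col]) rfl)
  have glue₂ : tmk (m 1, X.S (.right c)) = tmk (m 2, X.S (.left c)) :=
    tmk_eq (glue_of_pos (by norm_num [m, Idx.col]) rfl)
  have crossing (i : Fin 3) := dist_tmk_same (m i) (X.S (.left c)) (X.S (.right c))
  have htriangle := dist_triangle4 (tmk (m 0, X.S (.left c))) (tmk (m 0, X.S (.right c)))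
    (tmk (m 1, X.S (.right c))) (tmk (m 2, X.S (.right c)))
  have crossing₁ := glue₁ ▸ crossing 1
  have crossing₂ := glue₂ ▸ crossing 2
  rw [start_eq, end_eq]
  exact htriangle.trans (by linarith [crossing 0])

theorem dist_left_right_le_one_of_algebra (α : X.tensor ⟶ X) {c : ℝ} (hc : IsCantorEnd c) :
    dist (X.S (.left ⟨c, hc.mem_Icc⟩)) (X.S (.right ⟨c, hc.mem_Icc⟩)) ≤ 1 := by
  induction hc with
  | zero => exact (X.sq₁_bottom 0 1).le.trans (by norm_num)
  | one => exact (X.sq₁_top 0 1).le.trans (by norm_num)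
  | low hc ih =>
    exact (dist_left_right_le_of_algebra α (j := 0) (by decide) (by simp; ring)).trans ih
  | high hc ih =>
    exact (dist_left_right_le_of_algebra α (j := 2) (by decide) (by simp; ring)).trans ih

theorem dist_left_right_le_one_add_detour_of_algebra (α : X.tensor ⟶ X)
    (r s : Set.Icc (0 : ℝ) 1) :
    dist (X.S (.left r)) (X.S (.right s)) ≤ 1 + detour r s := by
  rw [← sub_le_iff_le_add']
  refine le_ciInf fun ⟨c, hc⟩ => ?_
  have hleft := X.sq₁_left r ⟨c, hc.mem_Icc⟩
  have hright := X.sq₁_right ⟨c, hc.mem_Icc⟩ s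
  rw [abs_sub_comm] at hleft
  linarith [dist_triangle4 (X.S (.left r)) (X.S (.left ⟨c, hc.mem_Icc⟩))
    (X.S (.right ⟨c, hc.mem_Icc⟩)) (X.S (.right s)), dist_left_right_le_one_of_algebra α hc]

theorem dist_S_algebra_le_coalgebra_of_abs_fst_sub_eq_one (α : Y.tensor ⟶ Y) (β : X ⟶ X.tensor)
    {p q : SquareBoundary} (h : |p.fst - q.fst| = 1) :
    dist (Y.S p) (Y.S q) ≤ dist (X.S p) (X.S q) := by
  have left_right (r s : Set.Icc (0 : ℝ) 1) :
      dist (Y.S (.left r)) (Y.S (.right s)) ≤ dist (X.S (.left r)) (X.S (.right s)) :=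
    (dist_left_right_le_one_add_detour_of_algebra α r s).trans
      (one_add_detour_le_dist_of_coalgebra β r s)
  rcases eq_or_eq_neg_of_abs_eq h with h | h
  · rw [SquareBoundary.eq_left (p := q) (by linarith [q.fst_nonneg, p.fst_le]),
      SquareBoundary.eq_right (p := p) (by linarith [q.fst_nonneg, p.fst_le]), dist_comm,
      dist_comm (X.S _)]
    exact left_right _ _
  · rw [SquareBoundary.eq_left (p := p) (by linarith [p.fst_nonneg, q.fst_le]),
      SquareBoundary.eq_right (p := q) (by linarith [p.fst_nonneg, q.fst_le])]
    exact left_right _ _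

theorem dist_S_algebra_le_coalgebra (α : Y.tensor ⟶ Y) (β : X ⟶ X.tensor)
    (p q : SquareBoundary) : dist (Y.S p) (Y.S q) ≤ dist (X.S p) (X.S q) := by
  rcases dist_S_le_taxi_or_opposite.{u} p q with h | h | h
  · exact (h Y).trans (X.sq₂ p q)
  · exact dist_S_algebra_le_coalgebra_of_abs_fst_sub_eq_one α β h
  · exact dist_S_algebra_le_coalgebra_of_abs_fst_sub_eq_one (transposeAlgebra α)
      (transposeCoalgebra β) (p := p.swap) (q := q.swap) h

end SquaMS

namespace SquaMS

variable {X Y : SquaMS.{u}}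

theorem pathDist_S_mono (hS : ∀ p q, dist (Y.S p) (Y.S q) ≤ dist (X.S p) (X.S q))
    (m n : Idx) (p q : SquareBoundary) :
    pathDist Y (m, Y.S p) (n, Y.S q) ≤ pathDist X (m, X.S p) (n, X.S q) := by
  let φ (k : Idx) (r : SquareBoundary) : ℝ := dist (tmk (k, Y.S r)) (tmk (n, Y.S q))
  have hφ : ∀ k r s, |φ k r - φ k s| ≤ dist (X.S r) (X.S s) / 3 := fun k r s => by
    refine (abs_dist_sub_le _ _ _).trans ((dist_tmk_same k _ _).trans ?_)
    linarith [hS r s]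
  have hcomparison := abs_sub_le_pathDist (φ := φ)
    (fun k r => ⟨dist_nonneg, Y.tensor.dist_le_two _ _⟩) hφ
    (fun k l r s hE => congrArg (dist · _) (tmk_eq_of_E hE)) m n p q
  have hbase : φ n q = 0 := dist_self _
  rw [hbase, sub_zero] at hcomparison
  exact (le_abs_self _).trans hcomparison

instance : BoundedSpace X :=
  ⟨Metric.isBounded_iff.2 ⟨2, fun x _ y _ => X.dist_le_two x y⟩⟩

/-! ### Maps that preserve the boundary -/

/-- A map preserving the boundary, not necessarily short. These maps carry the metric of uniform
convergence, for which they are complete whenever `Y` is. -/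
abbrev BoundaryMap (X Y : SquaMS.{u}) : Type u :=
  {h : UniformFun X Y // ∀ p, UniformFun.toFun h (X.S p) = Y.S p}

namespace BoundaryMap

instance : CoeFun (BoundaryMap X Y) fun _ => X → Y := ⟨fun h => UniformFun.toFun h.1⟩

/-- The map `M ⊗ X → M ⊗ Y`, `m ⊗ x ↦ m ⊗ h x`, induced by a boundary-preserving map `h`. -/
def tensorMap (h : BoundaryMap X Y) : BoundaryMap X.tensor Y.tensor :=
  ⟨UniformFun.ofFun <| Quotient.lift (fun a => (tmk (a.1, h a.2) : Tensor Y)) fun _ _ hab =>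
    respects (fun a : Idx × X => (tmk (a.1, h a.2) : Tensor Y)) (by
      rintro ⟨m, _⟩ ⟨n, _⟩ ⟨p, q, hE, rfl, rfl⟩
      simpa only [h.2] using tmk_eq_of_E hE) hab,
    fun p => congrArg (fun y => tmk (cell p, y)) (h.2 (rel p))⟩

theorem dist_le {h h' : BoundaryMap X Y} {c : ℝ} (hc : 0 ≤ c) :
    dist h h' ≤ c ↔ ∀ x, dist (h x) (h' x) ≤ c :=
  UniformFun.dist_le hc

theorem dist_apply_le (h h' : BoundaryMap X Y) (x : X) : dist (h x) (h' x) ≤ dist h h' :=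
  (dist_le dist_nonneg).1 le_rfl x

theorem dist_tensorMap_le (h h' : BoundaryMap X Y) :
    dist h.tensorMap h'.tensorMap ≤ dist h h' / 3 := by
  refine (dist_le (by positivity)).2 ?_
  rintro ⟨m, x⟩
  refine (dist_tmk_same m _ _).trans ?_
  gcongr
  exact dist_apply_le h h' x

/-- The defect of shortness shrinks because a path between different cells enters and leaves them
through the boundary, where there is no defect: only two steps of a third of the size remain. -/
theorem dist_tensorMap_apply_le {h : BoundaryMap X Y} {ε : ℝ}
    (hS : ∀ p q, dist (Y.S p) (Y.S q) ≤ dist (X.S p) (X.S q))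
    (hε : ∀ x y, dist (h x) (h y) ≤ dist x y + ε) (s t : X.tensor) :
    dist (h.tensorMap s) (h.tensorMap t) ≤ dist s t + 2 / 3 * ε := by
  obtain ⟨m, x⟩ := s
  obtain ⟨n, y⟩ := t
  have ε_nonneg : 0 ≤ ε := by simpa using hε x x
  rw [← sub_le_iff_le_add]
  change pathDist Y (m, h x) (n, h y) - 2 / 3 * ε ≤ pathDist X (m, x) (n, y)
  refine le_pathDist_of_forall_boundary₂ ?_ ?_ fun p q => ?_
  · have hbound : pathDist Y (m, h x) (n, h y) ≤ 2 := Y.tensor.dist_le_two (tmk _) (tmk _)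
    linarith
  · rintro rfl
    have hcell := dist_tmk_same m (h x) (h y)
    rw [dist_tmk] at hcell
    linarith [hε x y]
  · have henter := dist_tmk_same m (h x) (Y.S p)
    have hleave := dist_tmk_same n (Y.S q) (h y)
    have hεx := hε x (X.S p)
    have hεy := hε (X.S q) y
    rw [h.2] at hεx hεy
    have htriangle := dist_triangle4 (tmk (m, h x)) (tmk (m, Y.S p)) (tmk (n, Y.S q))
      (tmk (n, h y))
    rw [dist_tmk, dist_tmk (m, Y.S p)] at htriangle
    linarith [pathDist_S_mono hS m n p q]

/-- The map `α ∘ (M ⊗ h) ∘ β`, whose fixed points, when short, are the morphisms from the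
coalgebra `β` to the algebra `α`. -/
def hyloStep (β : X ⟶ X.tensor) (α : Y.tensor ⟶ Y) (h : BoundaryMap X Y) : BoundaryMap X Y :=
  ⟨UniformFun.ofFun fun x => Hom.toFun α (h.tensorMap (Hom.toFun β x)), fun p => by
    rw [UniformFun.toFun_ofFun, Hom.map_S β, h.tensorMap.2, Hom.map_S α]⟩

theorem contractingWith_hyloStep (β : X ⟶ X.tensor) (α : Y.tensor ⟶ Y) :
    ContractingWith (1 / 3) (hyloStep β α) := by
  refine ⟨by rw [← NNReal.coe_lt_coe]; norm_num, LipschitzWith.of_dist_le_mul fun h h' => ?_⟩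
  refine (dist_le (by positivity)).2 fun x => ?_
  refine (Hom.short α _ _).trans ((dist_apply_le _ _ _).trans ?_)
  rw [coe_one_third_mul]
  exact dist_tensorMap_le h h'

theorem dist_hyloStep_apply_le (β : X ⟶ X.tensor) (α : Y.tensor ⟶ Y) {h : BoundaryMap X Y} {ε : ℝ}
    (hε : ∀ x y, dist (h x) (h y) ≤ dist x y + ε) (x y : X) :
    dist (hyloStep β α h x) (hyloStep β α h y) ≤ dist x y + 2 / 3 * ε :=
  calc dist (hyloStep β α h x) (hyloStep β α h y)
    _ ≤ dist (h.tensorMap (Hom.toFun β x)) (h.tensorMap (Hom.toFun β y)) := Hom.short α _ _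
    _ ≤ dist (Hom.toFun β x) (Hom.toFun β y) + 2 / 3 * ε :=
      dist_tensorMap_apply_le (dist_S_algebra_le_coalgebra α β) hε _ _
    _ ≤ dist x y + 2 / 3 * ε := by gcongr; exact Hom.short β x y

theorem dist_apply_le_of_isFixedPt {β : X ⟶ X.tensor} {α : Y.tensor ⟶ Y} {h : BoundaryMap X Y}
    (hh : Function.IsFixedPt (hyloStep β α) h) (x y : X) : dist (h x) (h y) ≤ dist x y := by
  have defect (n : ℕ) : ∀ x y, dist (h x) (h y) ≤ dist x y + (2 / 3) ^ n * 2 := by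
    induction n with
    | zero =>
      intro x y
      linarith [Y.dist_le_two (h x) (h y), dist_nonneg (x := x) (y := y)]
    | succ n ih => simpa only [hh.eq, pow_succ', mul_assoc] using dist_hyloStep_apply_le β α ih
  have hlim := (tendsto_pow_atTop_nhds_zero_of_lt_one (r := (2 / 3 : ℝ)) (by norm_num)
    (by norm_num)).mul_const 2 |>.const_add (dist x y)
  rw [zero_mul, add_zero] at hlim
  exact ge_of_tendsto' hlim fun n => defect n x y

instance : Nonempty (BoundaryMap X Y) :=
  ⟨UniformFun.ofFun (Function.extend X.S Y.S fun _ => Y.S (.left 0)),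
    fun p => by rw [UniformFun.toFun_ofFun, X.S_injective.extend_apply]⟩

instance [CompleteSpace Y] : CompleteSpace (BoundaryMap X Y) := by
  have hclosed : IsClosed {h : UniformFun X Y | ∀ p, UniformFun.toFun h (X.S p) = Y.S p} := by
    simp only [Set.ofPred_forall]
    exact isClosed_iInter fun p =>
      isClosed_eq (UniformFun.lipschitzWith_eval (X.S p)).continuous continuous_const
  exact hclosed.completeSpace_coe

/-- A morphism, seen as a boundary-preserving map. -/
def ofHom (h : X ⟶ Y) : BoundaryMap X Y := ⟨UniformFun.ofFun (Hom.toFun h), Hom.map_S h⟩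

theorem ofHom_injective : Function.Injective (ofHom : (X ⟶ Y) → BoundaryMap X Y) :=
  fun _ _ h => Hom.ext (congrArg (fun g : BoundaryMap X Y => (g : X → Y)) h)

end BoundaryMap

/-! ### Morphisms from coalgebras to complete algebras -/

theorem exists_hom_of_complete [CompleteSpace Y] (β : X ⟶ tensorFunctor.obj X)
    (α : tensorFunctor.obj Y ⟶ Y) : ∃ h : X ⟶ Y, β ≫ tensorFunctor.map h ≫ α = h := by
  have hfixed := (BoundaryMap.contractingWith_hyloStep β α).fixedPoint_isFixedPt
  set h := ContractingWith.fixedPoint (BoundaryMap.hyloStep β α)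
    (BoundaryMap.contractingWith_hyloStep β α)
  let f : X ⟶ Y := ⟨h, BoundaryMap.dist_apply_le_of_isFixedPt hfixed, h.2⟩
  exact ⟨f, BoundaryMap.ofHom_injective hfixed⟩

theorem hom_unique_of_coalgebra (β : X ⟶ tensorFunctor.obj X) (α : tensorFunctor.obj Y ⟶ Y)
    {h h' : X ⟶ Y} (hh : β ≫ tensorFunctor.map h ≫ α = h)
    (hh' : β ≫ tensorFunctor.map h' ≫ α = h') : h = h' :=
  BoundaryMap.ofHom_injective <| (BoundaryMap.contractingWith_hyloStep β α).fixedPoint_unique'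
    (congrArg BoundaryMap.ofHom hh) (congrArg BoundaryMap.ofHom hh')

theorem nonempty_isTerminal_of_complete (Q : Endofunctor.Coalgebra tensorFunctor.{u})
    [CompleteSpace Q.V] [IsIso Q.str] : Nonempty (Limits.IsTerminal Q) := by
  choose h hh using fun B : Endofunctor.Coalgebra tensorFunctor.{u} =>
    exists_hom_of_complete B.str (inv Q.str)
  refine ⟨Limits.IsTerminal.ofUniqueHom
    (fun B => ⟨h B, by rw [← IsIso.comp_inv_eq, Category.assoc, hh]⟩) fun B g => ?_⟩
  refine Endofunctor.Coalgebra.Hom.ext (hom_unique_of_coalgebra B.str (inv Q.str) ?_ (hh B))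
  rw [← Category.assoc, IsIso.comp_inv_eq]
  exact g.h

end SquaMS

end

theorem mainTheorem2 :
    (∃ A : Endofunctor.Algebra SquaMS.tensorFunctor.{u}, Nonempty (Limits.IsInitial A)) ∧
    ∀ A : Endofunctor.Algebra SquaMS.tensorFunctor.{u}, Nonempty (Limits.IsInitial A) →
      ∃ (_ : IsIso A.str) (_ : IsIso (SquaMS.comparison A.a)),
        Nonempty (Limits.IsTerminal
          (⟨SquaMS.completionFunctor.obj A.a,
            SquaMS.completionFunctor.map (inv A.str) ≫ inv (SquaMS.comparison A.a)⟩ :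
              Endofunctor.Coalgebra SquaMS.tensorFunctor.{u})) := by
  refine ⟨⟨_, ⟨SquaMS.termAlgebraIsInitial⟩⟩, fun A ⟨hA⟩ => ?_⟩
  have isIso_str : IsIso A.str := Endofunctor.Algebra.Initial.str_isIso hA
  have isIso_comparison := SquaMS.isIso_comparison A.a
  refine ⟨isIso_str, isIso_comparison, ?_⟩
  let Q : Endofunctor.Coalgebra SquaMS.tensorFunctor.{u} :=
    ⟨SquaMS.completionFunctor.obj A.a,
      SquaMS.completionFunctor.map (inv A.str) ≫ inv (SquaMS.comparison A.a)⟩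
  have : CompleteSpace Q.V := inferInstanceAs (CompleteSpace (Completion A.a))
  have : IsIso Q.str := inferInstanceAs (IsIso (_ ≫ _))
  exact SquaMS.nonempty_isTerminal_of_complete Q
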